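/- **Conventions.** All $C^*$-algebras are complex and unital, all $*$-homomorphisms are unital, and $\otimes$ is the minimal (spatial) tensor product of $C^*$-algebras. A compact quantum space $\mathbb X$ is given by a unital $C^*$-algebra $C(\mathbb X)$; it is finite if $C(\mathbb X)$ is finite-dimensional. A quantum family of maps $\mathbb X\to\mathbb Y$ parametrized by $\mathbb D$ is a $*$-homomorphism $\Psi\colon C(\mathbb Y)\to C(\mathbb X)\otimes C(\mathbb D)$. The composition of $\Psi_1\colon C(\mathbb X_2)\to C(\mathbb X_1)\otimes C(\mathbb D_1)$ and $\Psi_2\colon C(\mathbb X_3)\to C(\mathbb X_2)\otimes C(\mathbb D_2)$ is $\Psi_1\vartriangle\Psi_2=(\Psi_1\otimes\mathrm{id})\circ\Psi_2\colon C(\mathbb X_3)\to C(\mathbb X_1)\otimes C(\mathbb D_1)\otimes C(\mathbb D_2)$. A quantum family $\Phi\colon C(\mathbb M)\to C(\mathbb M)\otimes C(\mathbb E)$ is the quantum family of all maps $\mathbb M\to\mathbb M$ if for every $\mathbb D$ and every quantum family $\Psi\colon C(\mathbb M)\to C(\mathbb M)\otimes C(\mathbb D)$ there is a unique $*$-homomorphism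 $\Lambda\colon C(\mathbb E)\to C(\mathbb D)$ with $(\mathrm{id}\otimes\Lambda)\circ\Phi=\Psi$. A state on $C(\mathbb M)$ is a continuous linear functional $\omega$ with $\|\omega\|=1$ and $\omega(a^*a)\ge 0$ for all $a$. A quantum family $\Psi\colon C(\mathbb M)\to C(\mathbb M)\otimes C(\mathbb D)$ preserves $\omega$ if $(\omega\otimes\mathrm{id})(\Psi(x))=\omega(x)\mathbb 1$ for all $x\in C(\mathbb M)$. **Theorem.** Let $\mathbb M$ be a finite quantum space and $\omega$ a state on $C(\mathbb M)$. There are a compact quantum space $\mathbb W$ and a quantum family $\Phi_\omega\colon C(\mathbb M)\to C(\mathbb M)\otimes C(\mathbb W)$ such that: 1. for every compact quantum space $\mathbb D$ and every quantum family $\Psi\colon C(\mathbb M)\to C(\mathbb M)\otimes C(\mathbb D)$ preserving $\omega$ there is a unique $*$-homomorphism $\Lambda\colon C(\mathbb W)\to C(\mathbb D)$ with $(\mathrm{id}\otimes\Lambda)\circ\Phi_\omega=\Psi$; 2. $\Phi_\omega$ preserves $\omega$; moreover $(\mathbb W,\Phi_\omega)$ is unique: if $(\mathbb W',\Phi')$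 also satisfies 1 and preserves $\omega$, there is a unique $*$-isomorphism $\theta\colon C(\mathbb W)\to C(\mathbb W')$ with $(\mathrm{id}\otimes\theta)\circ\Phi_\omega=\Phi'$; 3. $\mathbb W$ is a compact quantum semigroup with unit whose comultiplication is given by composition: there is a $*$-homomorphism $\Delta\colon C(\mathbb W)\to C(\mathbb W)\otimes C(\mathbb W)$ with $\Phi_\omega\vartriangle\Phi_\omega=(\mathrm{id}\otimes\Delta)\circ\Phi_\omega$ and $(\Delta\otimes\mathrm{id})\circ\Delta=(\mathrm{id}\otimes\Delta)\circ\Delta$, and there is a character $\epsilon$ of $C(\mathbb W)$ with $(\epsilon\otimes\mathrm{id})\circ\Delta=(\mathrm{id}\otimes\epsilon)\circ\Delta=\mathrm{id}$. Furthermore, if $\Phi\colon C(\mathbb M)\to C(\mathbb M)\otimes C(\mathbb E)$ is the quantum family of all maps $\mathbb M\to\mathbb M$, then there is a unique $*$-homomorphism $\Delta_{\mathbb E}\colon C(\mathbb E)\to C(\mathbb E)\otimes C(\mathbb E)$ with $\Phi\vartriangle\Phi=(\mathrm{id}\otimes\Delta_{\mathbb E})\circ\Phi$, there is a unique $*$-homomorphism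 $\Lambda\colon C(\mathbb E)\to C(\mathbb W)$ with $(\mathrm{id}\otimes\Lambda)\circ\Phi=\Phi_\omega$, and $(\Lambda\otimes\Lambda)\circ\Delta_{\mathbb E}=\Delta\circ\Lambda$. -/

import Mathlib

universe u

open scoped TensorProduct ComplexOrder InnerProductSpace

noncomputable section

/-! ### Completion of a `*`-algebra with respect to a `C*`-seminorm -/

/-- A `C*`-seminorm on a complex `*`-algebra. -/
structure CStarSeminorm (P : Type u) [Ring P] [StarRing P] [Algebra ℂ P] where
  toFun : P → ℝ
  add_le' : ∀ x y, toFun (x + y) ≤ toFun x + toFun y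
  smul' : ∀ (c : ℂ) (x : P), toFun (c • x) = ‖c‖ * toFun x
  mul_le' : ∀ x y, toFun (x * y) ≤ toFun x * toFun y
  star_mul_self' : ∀ x, toFun (star x * x) = toFun x * toFun x

namespace CStarSeminorm

variable {P : Type u} [Ring P] [StarRing P] [Algebra ℂ P] (p : CStarSeminorm P)

theorem map_zero' : p.toFun 0 = 0 := by simpa using p.smul' 0 0

theorem map_neg' (x : P) : p.toFun (-x) = p.toFun x := by simpa using p.smul' (-1) x

theorem nonneg' (x : P) : 0 ≤ p.toFun x := by
  have h := p.add_le' x (-x)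
  rw [add_neg_cancel, p.map_zero', p.map_neg'] at h
  linarith

theorem le_star (x : P) : p.toFun x ≤ p.toFun (star x) := by
  by_contra! h
  have h1 := p.star_mul_self' x
  have h2 := p.mul_le' (star x) x
  have h3 := p.nonneg' (star x)
  nlinarith

theorem map_star' (x : P) : p.toFun (star x) = p.toFun x :=
  le_antisymm (by simpa using p.le_star (star x)) (p.le_star x)

/-- The `*`-algebra `P`, viewed as a seminormed algebra with seminorm `p`. -/
@[nolint unusedArguments]
def Carrier (_p : CStarSeminorm P) : Type u := P

instance : Ring p.Carrier := inferInstanceAs (Ring P)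
instance : StarRing p.Carrier := inferInstanceAs (StarRing P)
instance : Algebra ℂ p.Carrier := inferInstanceAs (Algebra ℂ P)
instance [StarModule ℂ P] : StarModule ℂ p.Carrier := inferInstanceAs (StarModule ℂ P)

/-- The identity map from `P` to the seminormed algebra `(P, p)`. -/
def toCarrier : P →⋆ₐ[ℂ] p.Carrier := StarAlgHom.id ℂ P

/-- The identity map from the seminormed algebra `(P, p)` to `P`. -/
def ofCarrier : p.Carrier →⋆ₐ[ℂ] P := StarAlgHom.id ℂ P

instance : SeminormedRing p.Carrier where
  __ : Ring p.Carrier := inferInstance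
  __ : SeminormedAddCommGroup p.Carrier :=
    AddGroupSeminorm.toSeminormedAddCommGroup
      { toFun := fun x => p.toFun (p.ofCarrier x)
        map_zero' := p.map_zero'
        add_le' := p.add_le'
        neg' := p.map_neg' }
  norm_mul_le := p.mul_le'

theorem norm_toCarrier (x : P) : ‖p.toCarrier x‖ = p.toFun x := rfl

instance : NormedAlgebra ℂ p.Carrier where
  norm_smul_le c x := (p.smul' c x).le

instance : NormedStarGroup p.Carrier where
  norm_star_le x := (p.map_star' x).le

/-- The Hausdorff completion of `P` with respect to the `C*`-seminorm `p`. -/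
def Completed : Type u := UniformSpace.Completion p.Carrier

open UniformSpace

instance : NormedRing p.Completed := inferInstanceAs (NormedRing (Completion p.Carrier))
instance : CompleteSpace p.Completed := inferInstanceAs (CompleteSpace (Completion p.Carrier))
instance : Algebra ℂ p.Completed := inferInstanceAs (Algebra ℂ (Completion p.Carrier))

/-- The canonical map from `P` to its completion (as a mere function). -/
def coe (x : P) : p.Completed := ((p.toCarrier x : p.Carrier) : Completion p.Carrier)

theorem norm_coe (x : P) : ‖p.coe x‖ = p.toFun x :=
  Completion.norm_coe (p.toCarrier x)

theorem denseRange_coe : DenseRange p.coe :=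
  Completion.denseRange_coe (α := p.Carrier)

theorem coe_add (x y : P) : p.coe (x + y) = p.coe x + p.coe y :=
  Completion.coe_add (p.toCarrier x) (p.toCarrier y)

theorem coe_mul (x y : P) : p.coe (x * y) = p.coe x * p.coe y :=
  Completion.coe_mul (p.toCarrier x) (p.toCarrier y)

theorem coe_algebraMap (c : ℂ) : p.coe (algebraMap ℂ P c) = algebraMap ℂ p.Completed c := rfl

theorem coe_smul (c : ℂ) (x : P) : p.coe (c • x) = c • p.coe x := by
  rw [Algebra.smul_def, Algebra.smul_def, coe_mul, coe_algebraMap]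

theorem coe_one : p.coe 1 = 1 := by
  have := p.coe_algebraMap 1
  simpa using this

theorem coe_zero : p.coe 0 = 0 := by
  have := p.coe_algebraMap 0
  simpa using this

instance : NormedAlgebra ℂ p.Completed where
  norm_smul_le c x := by
    refine p.denseRange_coe.induction_on (p := fun x => ‖c • x‖ ≤ ‖c‖ * ‖x‖) x ?_ fun x => ?_
    · have h : Continuous fun x : p.Completed => c • x := by
        simp_rw [Algebra.smul_def]
        fun_prop
      exact isClosed_le h.norm (by fun_prop)
    · rw [← coe_smul, norm_coe, norm_coe]
      exact (p.smul' c x).le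

theorem isometry_star : Isometry (star : p.Carrier → p.Carrier) :=
  AddMonoidHomClass.isometry_of_norm (starAddEquiv (R := p.Carrier)) fun x => p.map_star' x

instance : Star p.Completed where
  star := Completion.map (star : p.Carrier → p.Carrier)

theorem continuous_star' : Continuous (star : p.Completed → p.Completed) :=
  Completion.continuous_map (f := (star : p.Carrier → p.Carrier))

theorem coe_star (x : P) : p.coe (star x) = star (p.coe x) :=
  (Completion.map_coe p.isometry_star.uniformContinuous (p.toCarrier x)).symm

instance : StarRing p.Completed where
  star_involutive x := by
    refine p.denseRange_coe.induction_on (p := fun x => star (star x) = x) x ?_ fun x => ?_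
    · exact isClosed_eq (p.continuous_star'.comp p.continuous_star') continuous_id
    · rw [← coe_star, ← coe_star, star_star]
  star_mul x y := by
    refine p.denseRange_coe.induction_on₂ (p := fun x y => star (x * y) = star y * star x)
      ?_ (fun x y => ?_) x y
    · exact isClosed_eq (p.continuous_star'.comp (by fun_prop))
        ((p.continuous_star'.comp continuous_snd).mul (p.continuous_star'.comp continuous_fst))
    · rw [← coe_star, ← coe_star, ← coe_mul, ← coe_mul, ← coe_star, star_mul]
  star_add x y := by
    refine p.denseRange_coe.induction_on₂ (p := fun x y => star (x + y) = star x + star y)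
      ?_ (fun x y => ?_) x y
    · exact isClosed_eq (p.continuous_star'.comp (by fun_prop))
        ((p.continuous_star'.comp continuous_fst).add (p.continuous_star'.comp continuous_snd))
    · rw [← coe_star, ← coe_star, ← coe_add, ← coe_add, ← coe_star, star_add]

instance : ContinuousStar p.Completed := ⟨p.continuous_star'⟩

instance : CStarRing p.Completed where
  norm_mul_self_le x := by
    refine p.denseRange_coe.induction_on (p := fun x => ‖x‖ * ‖x‖ ≤ ‖star x * x‖) x ?_
      fun x => ?_
    · exact isClosed_le (by fun_prop) ((p.continuous_star'.mul continuous_id).norm)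
    · rw [← coe_star, ← coe_mul, norm_coe, norm_coe, p.star_mul_self']

instance [StarModule ℂ P] : StarModule ℂ p.Completed where
  star_smul c x := by
    refine p.denseRange_coe.induction_on (p := fun x => star (c • x) = star c • star x) x ?_
      fun x => ?_
    · exact isClosed_eq (p.continuous_star'.comp (continuous_const_smul c))
        (p.continuous_star'.const_smul (star c))
    · rw [← coe_star, ← coe_smul, ← coe_smul, ← coe_star, star_smul]

instance [StarModule ℂ P] : CStarAlgebra p.Completed where

/-- The canonical `*`-homomorphism from `P` to its completion. -/
def of : P →⋆ₐ[ℂ] p.Completed where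
  toFun := p.coe
  map_one' := p.coe_one
  map_mul' := p.coe_mul
  map_zero' := p.coe_zero
  map_add' := p.coe_add
  commutes' := p.coe_algebraMap
  map_star' := p.coe_star

theorem norm_of (x : P) : ‖p.of x‖ = p.toFun x := p.norm_coe x

theorem denseRange_of : DenseRange p.of := p.denseRange_coe

/-- Bounded linear maps extend to the completion. -/
def liftL {F : Type*} [NormedAddCommGroup F] [NormedSpace ℂ F] [CompleteSpace F]
    (f : P →ₗ[ℂ] F) (C : ℝ) (_hf : ∀ x, ‖f x‖ ≤ C * p.toFun x) : p.Completed →L[ℂ] F :=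
  f.extendOfNorm p.of.toAlgHom.toLinearMap

theorem liftL_of {F : Type*} [NormedAddCommGroup F] [NormedSpace ℂ F] [CompleteSpace F]
    (f : P →ₗ[ℂ] F) (C : ℝ) (hf : ∀ x, ‖f x‖ ≤ C * p.toFun x) (x : P) :
    p.liftL f C hf (p.of x) = f x :=
  LinearMap.extendOfNorm_eq p.denseRange_of ⟨C, fun x => (hf x).trans_eq (by rw [← norm_of]; rfl)⟩ x

variable [StarModule ℂ P]

/-- Contractive unital `*`-homomorphisms extend to the completion. -/
def lift {B : Type*} [CStarAlgebra B] (f : P →⋆ₐ[ℂ] B) (hf : ∀ x, ‖f x‖ ≤ p.toFun x) :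
    p.Completed →⋆ₐ[ℂ] B :=
  let g := p.liftL f.toAlgHom.toLinearMap 1 (fun x => by simpa using hf x)
  have hg : ∀ x, g (p.of x) = f x := p.liftL_of _ _ _
  { toFun := g
    map_one' := by rw [← map_one p.of, hg, map_one]
    map_mul' := fun x y => by
      refine p.denseRange_of.induction_on₂ (p := fun x y => g (x * y) = g x * g y)
        (isClosed_eq (by fun_prop) (by fun_prop)) (fun x y => ?_) x y
      rw [← map_mul, hg, hg, hg, map_mul]
    map_zero' := map_zero g
    map_add' := map_add g
    commutes' := fun c => by rw [← AlgHomClass.commutes p.of, hg, AlgHomClass.commutes f]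
    map_star' := fun x => by
      refine p.denseRange_of.induction_on (p := fun x => g (star x) = star (g x)) x
        (isClosed_eq (g.continuous.comp continuous_star) (continuous_star.comp g.continuous)) fun x => ?_
      rw [← map_star, hg, hg, map_star] }

theorem lift_of {B : Type*} [CStarAlgebra B] (f : P →⋆ₐ[ℂ] B) (hf : ∀ x, ‖f x‖ ≤ p.toFun x)
    (x : P) : p.lift f hf (p.of x) = f x := p.liftL_of _ _ _ x

/-- The supremum of the pointwise bounded family of `C*`-seminorms `x ↦ ‖R i x‖`, where each
`R i` is a `*`-homomorphism into a `C*`-algebra. -/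
def ofFamily {P : Type u} [Ring P] [StarRing P] [Algebra ℂ P] {ι : Type*} {B : ι → Type*}
    [∀ i, CStarAlgebra (B i)] (R : ∀ i, P →⋆ₐ[ℂ] B i)
    (hR : ∀ x, BddAbove (Set.range fun i => ‖R i x‖)) : CStarSeminorm P where
  toFun x := ⨆ i, ‖R i x‖
  add_le' x y := by
    refine Real.iSup_le (fun i => ?_)
      (add_nonneg (Real.iSup_nonneg fun _ => norm_nonneg _) (Real.iSup_nonneg fun _ => norm_nonneg _))
    rw [map_add]
    exact (norm_add_le _ _).trans (add_le_add (le_ciSup (hR x) i) (le_ciSup (hR y) i))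
  smul' c x := by
    rw [Real.mul_iSup_of_nonneg (norm_nonneg c)]
    simp only [map_smul, norm_smul]
  mul_le' x y := by
    refine Real.iSup_le (fun i => ?_)
      (mul_nonneg (Real.iSup_nonneg fun _ => norm_nonneg _) (Real.iSup_nonneg fun _ => norm_nonneg _))
    rw [map_mul]
    exact (norm_mul_le _ _).trans (mul_le_mul (le_ciSup (hR x) i) (le_ciSup (hR y) i)
      (norm_nonneg _) (Real.iSup_nonneg fun _ => norm_nonneg _))
  star_mul_self' x := by
    have h0 : 0 ≤ ⨆ i, ‖R i x‖ := Real.iSup_nonneg fun _ => norm_nonneg _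
    have h (i) : ‖R i (star x * x)‖ = ‖R i x‖ * ‖R i x‖ := by
      rw [map_mul, map_star, CStarRing.norm_star_mul_self]
    simp only [h]
    refine le_antisymm (Real.iSup_le (fun i => mul_self_le_mul_self (norm_nonneg _)
      (le_ciSup (hR x) i)) (mul_self_nonneg _)) ?_
    have h1 : 0 ≤ ⨆ i, ‖R i x‖ * ‖R i x‖ := Real.iSup_nonneg fun _ => mul_self_nonneg _
    rw [← Real.sqrt_le_sqrt_iff h1, Real.sqrt_mul_self h0]
    refine Real.iSup_le (fun i => Real.le_sqrt_of_sq_le ?_) (Real.sqrt_nonneg _)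
    rw [sq]
    refine le_ciSup (f := fun i => ‖R i x‖ * ‖R i x‖) ⟨(⨆ i, ‖R i x‖) * (⨆ i, ‖R i x‖), ?_⟩ i
    rintro _ ⟨j, rfl⟩
    exact mul_self_le_mul_self (norm_nonneg _) (le_ciSup (hR x) j)

end CStarSeminorm

/-! ### Representations on Hilbert spaces and their tensor products -/

/-- A unital `*`-representation of a `*`-algebra by bounded operators on a Hilbert space. -/
structure HilbertRep (A : Type u) [Ring A] [StarRing A] [Algebra ℂ A] where
  Space : Type u
  [normedAddCommGroup : NormedAddCommGroup Space]
  [innerProductSpace : InnerProductSpace ℂ Space]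
  [completeSpace : CompleteSpace Space]
  hom : A →⋆ₐ[ℂ] (Space →L[ℂ] Space)

attribute [instance] HilbertRep.normedAddCommGroup HilbertRep.innerProductSpace
  HilbertRep.completeSpace

/-- The tensor product of Hilbert spaces: the completion of the algebraic tensor product. -/
def HilbertTensor (H K : Type u) [NormedAddCommGroup H] [InnerProductSpace ℂ H]
    [NormedAddCommGroup K] [InnerProductSpace ℂ K] : Type u :=
  UniformSpace.Completion (H ⊗[ℂ] K)

section OpTensor

open UniformSpace

variable {H K : Type u} [NormedAddCommGroup H] [InnerProductSpace ℂ H]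
  [NormedAddCommGroup K] [InnerProductSpace ℂ K]

instance : NormedAddCommGroup (HilbertTensor H K) :=
  inferInstanceAs (NormedAddCommGroup (Completion (H ⊗[ℂ] K)))
instance : InnerProductSpace ℂ (HilbertTensor H K) :=
  inferInstanceAs (InnerProductSpace ℂ (Completion (H ⊗[ℂ] K)))
instance : CompleteSpace (HilbertTensor H K) :=
  inferInstanceAs (CompleteSpace (Completion (H ⊗[ℂ] K)))

variable (H K) in
/-- The inclusion of the algebraic tensor product into the Hilbert space tensor product. -/
def HilbertTensor.of : H ⊗[ℂ] K →ₗᵢ[ℂ] HilbertTensor H K := Completion.toComplₗᵢ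

theorem HilbertTensor.denseRange_of : DenseRange (HilbertTensor.of H K) :=
  Completion.denseRange_coe

theorem HilbertTensor.denseRange_of_comp {H' : Type u} [NormedAddCommGroup H']
    [InnerProductSpace ℂ H'] (f : H' →ₗᵢ[ℂ] H) (hf : DenseRange f) :
    DenseRange ((HilbertTensor.of H K).comp (TensorProduct.mapIsometry f LinearIsometry.id)) := by
  let S : Submodule ℂ (HilbertTensor H K) := (LinearMap.range ((HilbertTensor.of H K).comp
    (TensorProduct.mapIsometry f LinearIsometry.id)).toLinearMap).topologicalClosure
  have hS : IsClosed (S : Set (HilbertTensor H K)) := Submodule.isClosed_topologicalClosure _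
  have h1 (h : H) (k : K) : HilbertTensor.of H K (h ⊗ₜ k) ∈ S := by
    refine hf.induction_on (p := fun h => HilbertTensor.of H K (h ⊗ₜ k) ∈ S) h
      (hS.preimage ?_) fun h' => ?_
    · exact (HilbertTensor.of H K).continuous.comp
        (TensorProduct.continuous_tmul.comp (Continuous.prodMk continuous_id continuous_const))
    · exact Submodule.le_topologicalClosure _ ⟨h' ⊗ₜ k, rfl⟩
  have h2 (x : H ⊗[ℂ] K) : HilbertTensor.of H K x ∈ S := by
    induction x using TensorProduct.induction_on with
    | zero => rw [map_zero]; exact S.zero_mem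
    | add x y hx hy => rw [map_add]; exact S.add_mem hx hy
    | tmul a b => exact h1 a b
  intro t
  exact HilbertTensor.denseRange_of.induction_on (p := fun t => t ∈ S) t hS h2

/-- The tensor product `S ⊗ T` of bounded operators. -/
def opTensor (S : H →L[ℂ] H) (T : K →L[ℂ] K) : HilbertTensor H K →L[ℂ] HilbertTensor H K :=
  (TensorProduct.mapL S T).completion

theorem opTensor_of (S : H →L[ℂ] H) (T : K →L[ℂ] K) (v : H ⊗[ℂ] K) :
    opTensor S T (HilbertTensor.of H K v) = HilbertTensor.of H K (TensorProduct.mapL S T v) :=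
  ContinuousLinearMap.completion_apply_coe (TensorProduct.mapL S T) v

theorem HilbertTensor.clm_ext {F : Type*} [NormedAddCommGroup F] [NormedSpace ℂ F]
    {S T : HilbertTensor H K →L[ℂ] F}
    (h : ∀ v : H ⊗[ℂ] K, S (HilbertTensor.of H K v) = T (HilbertTensor.of H K v)) : S = T := by
  ext x
  exact HilbertTensor.denseRange_of.induction_on (p := fun x => S x = T x) x
    (isClosed_eq S.continuous T.continuous) h

theorem HilbertTensor.opNorm_le {F : Type*} [NormedAddCommGroup F] [NormedSpace ℂ F]
    (S : HilbertTensor H K →L[ℂ] F) {C : ℝ} (hC : 0 ≤ C)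
    (h : ∀ v : H ⊗[ℂ] K, ‖S (HilbertTensor.of H K v)‖ ≤ C * ‖v‖) : ‖S‖ ≤ C := by
  refine ContinuousLinearMap.opNorm_le_bound _ hC fun x => ?_
  refine HilbertTensor.denseRange_of.induction_on (p := fun x => ‖S x‖ ≤ C * ‖x‖) x
    (isClosed_le (by fun_prop) (by fun_prop)) fun v => ?_
  rw [LinearIsometry.norm_map]
  exact h v

theorem norm_opTensor_le (S : H →L[ℂ] H) (T : K →L[ℂ] K) : ‖opTensor S T‖ ≤ ‖S‖ * ‖T‖ := by
  refine HilbertTensor.opNorm_le _ (by positivity) fun v => ?_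
  rw [opTensor_of, LinearIsometry.norm_map]
  exact ((TensorProduct.mapL S T).le_opNorm v).trans
    (mul_le_mul_of_nonneg_right (TensorProduct.norm_mapL_le S T) (norm_nonneg _))

theorem opTensor_star [CompleteSpace H] [CompleteSpace K] (S : H →L[ℂ] H) (T : K →L[ℂ] K) :
    opTensor (star S) (star T) = star (opTensor S T) := by
  rw [ContinuousLinearMap.star_eq_adjoint (opTensor S T), ContinuousLinearMap.eq_adjoint_iff]
  intro x y
  refine HilbertTensor.denseRange_of.induction_on₂
    (p := fun x y => inner ℂ (opTensor (star S) (star T) x) y = inner ℂ x (opTensor S T y))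
    (isClosed_eq (by fun_prop) (by fun_prop)) (fun v w => ?_) x y
  rw [opTensor_of, opTensor_of, LinearIsometry.inner_map_map, LinearIsometry.inner_map_map]
  induction v using TensorProduct.induction_on with
  | zero => simp
  | add v v' h h' => simp only [map_add, inner_add_left, h, h']
  | tmul a b =>
    induction w using TensorProduct.induction_on with
    | zero => simp
    | add w w' h h' => simp only [map_add, inner_add_right, h, h']
    | tmul c d =>
      simp [ContinuousLinearMap.star_eq_adjoint, ContinuousLinearMap.adjoint_inner_left]

variable [CompleteSpace H] [CompleteSpace K]
  {P Q : Type u} [Ring P] [StarRing P] [Algebra ℂ P] [StarModule ℂ P]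
  [Ring Q] [StarRing Q] [Algebra ℂ Q] [StarModule ℂ Q]

/-- The underlying algebra homomorphism of `tensorRep`. -/
def tensorRepAlg (π : P →⋆ₐ[ℂ] (H →L[ℂ] H)) (ρ : Q →⋆ₐ[ℂ] (K →L[ℂ] K)) :
    P ⊗[ℂ] Q →ₐ[ℂ] (HilbertTensor H K →L[ℂ] HilbertTensor H K) :=
  Algebra.TensorProduct.algHomOfLinearMapTensorProduct (R := ℂ) (S := ℂ)
    (TensorProduct.lift (LinearMap.mk₂ ℂ (fun a b => opTensor (π a) (ρ b))
      (fun a a' b => HilbertTensor.clm_ext fun v => by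
        simp only [add_apply, opTensor_of, map_add,
          TensorProduct.mapL_add_left])
      (fun c a b => HilbertTensor.clm_ext fun v => by
        simp only [smul_apply, opTensor_of, map_smul,
          TensorProduct.mapL_smul_left])
      (fun a b b' => HilbertTensor.clm_ext fun v => by
        simp only [add_apply, opTensor_of, map_add,
          TensorProduct.mapL_add_right])
      (fun c a b => HilbertTensor.clm_ext fun v => by
        simp only [smul_apply, opTensor_of, map_smul,
          TensorProduct.mapL_smul_right])))
    (fun a a' b b' => HilbertTensor.clm_ext fun v => by
      simp only [TensorProduct.lift.tmul, LinearMap.mk₂_apply, map_mul,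
        mul_apply_eq_comp, opTensor_of, TensorProduct.mapL_mul])
    (HilbertTensor.clm_ext fun v => by
      simp only [TensorProduct.lift.tmul, LinearMap.mk₂_apply, map_one, opTensor_of,
        one_apply_eq_self]
      exact congrArg _ (by simp [ContinuousLinearMap.one_def]))
theorem tensorRepAlg_star (π : P →⋆ₐ[ℂ] (H →L[ℂ] H)) (ρ : Q →⋆ₐ[ℂ] (K →L[ℂ] K)) (x : P ⊗[ℂ] Q) :
    tensorRepAlg π ρ (star x) = star (tensorRepAlg π ρ x) := by
  induction x using TensorProduct.induction_on with
  | zero => rw [star_zero, map_zero, star_zero]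
  | add x y hx hy => rw [star_add, map_add, map_add, star_add, hx, hy]
  | tmul a b =>
    change opTensor (π (star a)) (ρ (star b)) = star (opTensor (π a) (ρ b))
    rw [map_star, map_star, opTensor_star]

/-- The tensor product `π ⊗ ρ` of two representations: the representation of the algebraic
tensor product `P ⊗ Q` on the Hilbert space `H ⊗ K` with `(π ⊗ ρ)(a ⊗ b) = π a ⊗ ρ b`. -/
def tensorRep (π : P →⋆ₐ[ℂ] (H →L[ℂ] H)) (ρ : Q →⋆ₐ[ℂ] (K →L[ℂ] K)) :
    P ⊗[ℂ] Q →⋆ₐ[ℂ] (HilbertTensor H K →L[ℂ] HilbertTensor H K) where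
  __ := tensorRepAlg π ρ
  map_star' := tensorRepAlg_star π ρ

theorem tensorRep_tmul (π : P →⋆ₐ[ℂ] (H →L[ℂ] H)) (ρ : Q →⋆ₐ[ℂ] (K →L[ℂ] K)) (a : P) (b : Q) :
    tensorRep π ρ (a ⊗ₜ b) = opTensor (π a) (ρ b) := rfl

end OpTensor

/-! ### Existence of enough states and representations -/

open Complex in
theorem CStarAlgebra.functional_nonneg_of_norm_le_one {A : Type u} [CStarAlgebra A] [Nontrivial A] (φ : A →L[ℂ] ℂ) (h1 : ‖φ‖ ≤ 1) (h2 : φ 1 = 1)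
   (a : A) : 0 ≤ φ (star a * a) := by
  let _ := CStarAlgebra.spectralOrder A
  let _ := CStarAlgebra.spectralOrderedRing A
  have key (b : A) (hb : IsSelfAdjoint b) : (φ b).im = 0 := by
    by_contra hne
    have ineq (t : ℝ) : ((φ b).im + t) ^ 2 ≤ ‖b‖ ^ 2 + t ^ 2 := by
      have e1 : φ (b + (t * I) • (1 : A)) = φ b + t * I := by simp [h2]
      have e2 : ‖φ (b + (t * I) • (1 : A))‖ ≤ ‖b + (t * I) • (1 : A)‖ :=
        (φ.le_opNorm _).trans (mul_le_of_le_one_left (norm_nonneg _) h1)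
      have e3 : star (b + (t * I) • (1 : A)) * (b + (t * I) • (1 : A)) = b * b + ((t : ℂ) ^ 2) • (1 : A) := by
        rw [star_add, hb.star_eq, star_smul, star_one]
        simp only [star_mul', Complex.star_def, Complex.conj_ofReal, Complex.conj_I, add_mul, mul_add, smul_add, smul_mul_assoc, mul_smul_comm, one_mul, mul_one, smul_smul]
        have : (t * I * (t * -I) : ℂ) = t ^ 2 := by ring_nf; simp
        rw [this]
        simp only [mul_neg, neg_smul]
        abel
      have e4 : ‖b + (t * I) • (1 : A)‖ ^ 2 ≤ ‖b‖ ^ 2 + t ^ 2 := by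
        rw [sq, ← CStarRing.norm_star_mul_self, e3]
        refine (norm_add_le _ _).trans (add_le_add ?_ ?_)
        · rw [sq]; exact norm_mul_le _ _
        · rw [norm_smul]; simp
      have e5 : ((φ b).im + t) ^ 2 ≤ ‖φ b + t * I‖ ^ 2 := by
        rw [← Complex.normSq_eq_norm_sq, Complex.normSq_apply]
        simp
        nlinarith [mul_self_nonneg (φ b).re]
      rw [← e1] at e5
      have : ‖φ (b + (t * I) • (1 : A))‖ ^ 2 ≤ ‖b + (t * I) • (1 : A)‖ ^ 2 := by gcongr
      linarith
    have := ineq ((‖b‖ ^ 2 + 1) / (2 * (φ b).im))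
    have h3 : 2 * (φ b).im * ((‖b‖ ^ 2 + 1) / (2 * (φ b).im)) = ‖b‖ ^ 2 + 1 := by field_simp
    nlinarith [sq_nonneg (φ b).im]
  set b := star a * a with hb
  have hbs : IsSelfAdjoint b := .star_mul_self a
  have hb0 : 0 ≤ b := star_mul_self_nonneg a
  have hn : ‖algebraMap ℝ A ‖b‖ - b‖ ≤ ‖b‖ := by
    rw [CStarAlgebra.norm_le_iff_le_algebraMap _ (norm_nonneg _) (sub_nonneg.2 hbs.le_algebraMap_norm_self)]
    exact sub_le_self _ hb0
  have h4 : ‖φ (algebraMap ℝ A ‖b‖ - b)‖ ≤ ‖b‖ :=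
    ((φ.le_opNorm _).trans (mul_le_of_le_one_left (norm_nonneg _) h1)).trans hn
  have h5 : φ (algebraMap ℝ A ‖b‖) = ‖b‖ := by
    rw [IsScalarTower.algebraMap_apply ℝ ℂ A, Algebra.algebraMap_eq_smul_one, map_smul, h2]
    simp
  rw [map_sub, h5] at h4
  rw [Complex.nonneg_iff]
  refine ⟨?_, (key b hbs).symm⟩
  have := (Complex.re_le_norm _).trans h4
  simp at this
  exact this

theorem CStarAlgebra.exists_positive_functional {A : Type u} [CStarAlgebra A] [Nontrivial A] (b : A) :
    ∃ φ : A →ₗ[ℂ] ℂ, (∀ a, 0 ≤ φ (star a * a)) ∧ φ 1 = 1 ∧ φ (star b * b) = (‖b‖ ^ 2 : ℝ) := by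
  let _ := CStarAlgebra.spectralOrder A
  let _ := CStarAlgebra.spectralOrderedRing A
  set c := star b * b with hc
  have hcn : ‖c‖ = ‖b‖ ^ 2 := by rw [hc, CStarRing.norm_star_mul_self, sq]
  have hc0 : 0 ≤ c := star_mul_self_nonneg b
  obtain ⟨g, hg, hg'⟩ := exists_dual_vector'' ℂ (1 + c)
  have hnorm : ‖1 + c‖ = 1 + ‖c‖ := by
    have h11 : 1 ≤ ‖1 + c‖ := by
      have := CStarAlgebra.norm_le_norm_of_nonneg_of_le (zero_le_one (α := A))
        (le_add_of_nonneg_right hc0 : (1 : A) ≤ 1 + c)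
      simpa using this
    refine le_antisymm ((norm_add_le _ _).trans (by simp)) ?_
    have h12 : c ≤ algebraMap ℝ A (‖1 + c‖ - 1) := by
      have := IsSelfAdjoint.le_algebraMap_norm_self (a := 1 + c) (.of_nonneg (by positivity))
      rw [map_sub, map_one, le_sub_iff_add_le, add_comm]
      exact this
    have := (CStarAlgebra.norm_le_iff_le_algebraMap c (by linarith) hc0).2 h12
    linarith
  have h1 : ‖g 1‖ ≤ 1 := (g.le_opNorm _).trans (by simpa using hg)
  have h2 : ‖g c‖ ≤ ‖c‖ := (g.le_opNorm _).trans (mul_le_of_le_one_left (norm_nonneg _) hg)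
  rw [map_add, hnorm] at hg'
  have hre := congrArg Complex.re hg'
  have e1 : (g 1).re = 1 := by
    have := (Complex.re_le_norm _).trans h1
    have := (Complex.re_le_norm _).trans h2
    simp at hre
    linarith
  have e2 : (g c).re = ‖c‖ := by
    simp at hre
    linarith
  have f1 : g 1 = 1 := by
    have := Complex.re_eq_norm.1 (le_antisymm (Complex.re_le_norm _) (h1.trans e1.ge))
    rw [Complex.nonneg_iff] at this
    exact Complex.ext (by simpa using e1) (by simpa using this.2.symm)
  have f2 : g c = ‖c‖ := by
    have := Complex.re_eq_norm.1 (le_antisymm (Complex.re_le_norm _) (h2.trans e2.ge))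
    rw [Complex.nonneg_iff] at this
    exact Complex.ext (by simpa using e2) (by simpa using this.2.symm)
  exact ⟨g, CStarAlgebra.functional_nonneg_of_norm_le_one g hg f1, f1, by rw [← hcn]; exact f2⟩

theorem CStarAlgebra.exists_gns {A : Type u} [CStarAlgebra A] (φ : A →ₗ[ℂ] ℂ) (hφ : ∀ a, 0 ≤ φ (star a * a)) :
   ∃ (H : Type u) (_ : NormedAddCommGroup H) (_ : InnerProductSpace ℂ H) (_ : CompleteSpace H) (π : A →⋆ₐ[ℂ] H →L[ℂ] H) (ξ : H), ∀ a, inner ℂ ξ (π a ξ) = φ a := by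
  let _ := CStarAlgebra.spectralOrder A
  let _ := CStarAlgebra.spectralOrderedRing A
  let f : A →ₚ[ℂ] ℂ := .mk₀ φ fun a ha => by
    obtain ⟨b, rfl⟩ := CStarAlgebra.nonneg_iff_eq_star_mul_self.1 ha
    exact hφ b
  refine ⟨f.GNS, inferInstance, inferInstance, inferInstance, f.gnsStarAlgHom, (f.toPreGNS 1 : f.PreGNS), fun a => ?_⟩
  change inner ℂ _ (f.gnsNonUnitalStarAlgHom a _) = _
  rw [PositiveLinearMap.gnsNonUnitalStarAlgHom_apply_coe, UniformSpace.Completion.inner_coe, PositiveLinearMap.preGNS_inner_def]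
  simp
  rfl

theorem inner_self_eq_ofReal {H : Type*} [NormedAddCommGroup H] [InnerProductSpace ℂ H] (x : H) :
    inner ℂ x x = ((‖x‖ ^ 2 : ℝ) : ℂ) := by
  rw [inner_self_eq_norm_sq_to_K]
  simp

/-- The norm of a `C*`-algebra is determined by its Hilbert space representations. -/
theorem CStarAlgebra.norm_le_of_forall_rep {A : Type u} [CStarAlgebra A] (b : A) (C : ℝ)
    (hC : 0 ≤ C) (h : ∀ r : HilbertRep A, ‖r.hom b‖ ≤ C) : ‖b‖ ≤ C := by
  rcases subsingleton_or_nontrivial A with _ | _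
  · rw [Subsingleton.elim b 0, norm_zero]
    exact hC
  obtain ⟨φ, hφ, h1, h2⟩ := CStarAlgebra.exists_positive_functional b
  obtain ⟨H, _, _, _, π, ξ, hξ⟩ := CStarAlgebra.exists_gns φ hφ
  have e1 : ‖ξ‖ ^ 2 = 1 := by
    have := hξ 1
    rw [map_one, h1, one_apply_eq_self, inner_self_eq_ofReal] at this
    exact_mod_cast this
  have e1' : ‖ξ‖ = 1 := by nlinarith [norm_nonneg ξ]
  have e2 : ‖π b ξ‖ ^ 2 = ‖b‖ ^ 2 := by
    have := hξ (star b * b)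
    rw [map_mul, map_star, h2, mul_apply_eq_comp,
      ContinuousLinearMap.star_eq_adjoint, ContinuousLinearMap.adjoint_inner_right,
      inner_self_eq_ofReal] at this
    exact_mod_cast this
  have e3 : ‖π b ξ‖ = ‖b‖ := by
    rwa [sq_eq_sq₀ (norm_nonneg _) (norm_nonneg _)] at e2
  rw [← e3]
  have := (π b).le_opNorm ξ
  rw [e1', mul_one] at this
  exact this.trans (h ⟨H, π⟩)

/-! ### Minimal tensor products -/

section MinTensor

/-- The tensor product of `*`-homomorphisms on the algebraic tensor products. -/
def algTensorMap {P Q P' Q' : Type*} [Ring P] [StarRing P] [Algebra ℂ P] [StarModule ℂ P]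
    [Ring Q] [StarRing Q] [Algebra ℂ Q] [StarModule ℂ Q]
    [Ring P'] [StarRing P'] [Algebra ℂ P'] [StarModule ℂ P']
    [Ring Q'] [StarRing Q'] [Algebra ℂ Q'] [StarModule ℂ Q']
    (f : P →⋆ₐ[ℂ] P') (g : Q →⋆ₐ[ℂ] Q') : P ⊗[ℂ] Q →⋆ₐ[ℂ] P' ⊗[ℂ] Q' where
  __ := Algebra.TensorProduct.map f.toAlgHom g.toAlgHom
  map_star' x := by
    change Algebra.TensorProduct.map f.toAlgHom g.toAlgHom (star x) =
      star (Algebra.TensorProduct.map f.toAlgHom g.toAlgHom x)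
    induction x using TensorProduct.induction_on with
    | zero => simp
    | add x y hx hy => rw [star_add, map_add, map_add, star_add, hx, hy]
    | tmul a b =>
      rw [TensorProduct.star_tmul, Algebra.TensorProduct.map_tmul, Algebra.TensorProduct.map_tmul,
        TensorProduct.star_tmul]
      exact congrArg₂ (· ⊗ₜ[ℂ] ·) (map_star f a) (map_star g b)

theorem algTensorMap_tmul {P Q P' Q' : Type*} [Ring P] [StarRing P] [Algebra ℂ P] [StarModule ℂ P]
    [Ring Q] [StarRing Q] [Algebra ℂ Q] [StarModule ℂ Q]
    [Ring P'] [StarRing P'] [Algebra ℂ P'] [StarModule ℂ P']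
    [Ring Q'] [StarRing Q'] [Algebra ℂ Q'] [StarModule ℂ Q']
    (f : P →⋆ₐ[ℂ] P') (g : Q →⋆ₐ[ℂ] Q') (a : P) (b : Q) :
    algTensorMap f g (a ⊗ₜ b) = f a ⊗ₜ g b := rfl

theorem tensorRep_algTensorMap {P Q P' Q' H K : Type u}
    [Ring P] [StarRing P] [Algebra ℂ P] [StarModule ℂ P]
    [Ring Q] [StarRing Q] [Algebra ℂ Q] [StarModule ℂ Q]
    [Ring P'] [StarRing P'] [Algebra ℂ P'] [StarModule ℂ P']
    [Ring Q'] [StarRing Q'] [Algebra ℂ Q'] [StarModule ℂ Q']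
    [NormedAddCommGroup H] [InnerProductSpace ℂ H] [CompleteSpace H]
    [NormedAddCommGroup K] [InnerProductSpace ℂ K] [CompleteSpace K]
    (π : P' →⋆ₐ[ℂ] (H →L[ℂ] H)) (ρ : Q' →⋆ₐ[ℂ] (K →L[ℂ] K))
    (f : P →⋆ₐ[ℂ] P') (g : Q →⋆ₐ[ℂ] Q') (x : P ⊗[ℂ] Q) :
    tensorRep π ρ (algTensorMap f g x) = tensorRep (π.comp f) (ρ.comp g) x := by
  induction x using TensorProduct.induction_on with
  | zero => rw [map_zero, map_zero, map_zero]
  | add x y hx hy => rw [map_add, map_add, map_add, hx, hy]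
  | tmul a b => rfl

variable (A B C D : Type u) [CStarAlgebra A] [CStarAlgebra B] [CStarAlgebra C] [CStarAlgebra D]

variable {A B} in
theorem bddAbove_tensorRep (x : A ⊗[ℂ] B) : BddAbove (Set.range
    fun r : HilbertRep A × HilbertRep B => ‖tensorRep r.1.hom r.2.hom x‖) := by
  induction x using TensorProduct.induction_on with
  | zero => exact ⟨0, by rintro _ ⟨r, rfl⟩; simp⟩
  | add x y hx hy =>
    obtain ⟨c, hc⟩ := hx
    obtain ⟨d, hd⟩ := hy
    refine ⟨c + d, ?_⟩
    rintro _ ⟨r, rfl⟩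
    simp only [map_add]
    exact (norm_add_le _ _).trans (add_le_add (hc ⟨r, rfl⟩) (hd ⟨r, rfl⟩))
  | tmul a b =>
    refine ⟨‖a‖ * ‖b‖, ?_⟩
    rintro _ ⟨r, rfl⟩
    exact (norm_opTensor_le _ _).trans (mul_le_mul (NonUnitalStarAlgHom.norm_apply_le _ _)
      (NonUnitalStarAlgHom.norm_apply_le _ _) (norm_nonneg _) (norm_nonneg _))

/-- The minimal (spatial) `C*`-norm on the algebraic tensor product: the supremum of
`‖(π ⊗ ρ)(x)‖` over all Hilbert space representations `π` of `A` and `ρ` of `B`. -/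
def minSeminorm : CStarSeminorm (A ⊗[ℂ] B) :=
  CStarSeminorm.ofFamily (fun r : HilbertRep A × HilbertRep B => tensorRep r.1.hom r.2.hom)
    bddAbove_tensorRep

/-- The minimal tensor product of `C*`-algebras. -/
abbrev MinTensor : Type u := (minSeminorm A B).Completed

infixl:100 " ⊗ₘ " => MinTensor

/-- The canonical map from the algebraic to the minimal tensor product. -/
abbrev MinTensor.of : A ⊗[ℂ] B →⋆ₐ[ℂ] A ⊗ₘ B := (minSeminorm A B).of

variable {A B C D}

theorem norm_tensorRep_le_minSeminorm (r : HilbertRep A) (s : HilbertRep B) (x : A ⊗[ℂ] B) :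
    ‖tensorRep r.hom s.hom x‖ ≤ (minSeminorm A B).toFun x :=
  le_ciSup (bddAbove_tensorRep x) (r, s)

theorem minSeminorm_le (x : A ⊗[ℂ] B) {c : ℝ} (hc : 0 ≤ c)
    (h : ∀ (r : HilbertRep A) (s : HilbertRep B), ‖tensorRep r.hom s.hom x‖ ≤ c) :
    (minSeminorm A B).toFun x ≤ c :=
  Real.iSup_le (fun r => h r.1 r.2) hc

theorem minSeminorm_tmul_le (a : A) (b : B) : (minSeminorm A B).toFun (a ⊗ₜ b) ≤ ‖a‖ * ‖b‖ :=
  minSeminorm_le _ (by positivity) fun _ _ =>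
    (norm_opTensor_le _ _).trans (mul_le_mul (NonUnitalStarAlgHom.norm_apply_le _ _)
      (NonUnitalStarAlgHom.norm_apply_le _ _) (norm_nonneg _) (norm_nonneg _))

/-- The tensor product `f ⊗ g : A ⊗ B → C ⊗ D` of unital `*`-homomorphisms. -/
def MinTensor.map (f : A →⋆ₐ[ℂ] C) (g : B →⋆ₐ[ℂ] D) : A ⊗ₘ B →⋆ₐ[ℂ] C ⊗ₘ D :=
  (minSeminorm A B).lift ((MinTensor.of C D).comp (algTensorMap f g)) fun x => by
    rw [StarAlgHom.comp_apply, CStarSeminorm.norm_of]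
    refine minSeminorm_le _ (CStarSeminorm.nonneg' _ _) fun r s => ?_
    rw [tensorRep_algTensorMap]
    exact norm_tensorRep_le_minSeminorm ⟨r.Space, r.hom.comp f⟩ ⟨s.Space, s.hom.comp g⟩ x

theorem MinTensor.map_of (f : A →⋆ₐ[ℂ] C) (g : B →⋆ₐ[ℂ] D) (x : A ⊗[ℂ] B) :
    MinTensor.map f g (MinTensor.of A B x) = MinTensor.of C D (algTensorMap f g x) :=
  CStarSeminorm.lift_of _ _ _ x

/-- The representation `π ⊗ ρ` of the minimal tensor product. -/
def MinTensor.rep (r : HilbertRep A) (s : HilbertRep B) : HilbertRep (A ⊗ₘ B) where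
  Space := HilbertTensor r.Space s.Space
  hom := (minSeminorm A B).lift (tensorRep r.hom s.hom) (norm_tensorRep_le_minSeminorm r s)

theorem MinTensor.rep_comp_of (r : HilbertRep A) (s : HilbertRep B) :
    (MinTensor.rep r s).hom.comp (MinTensor.of A B) = tensorRep r.hom s.hom :=
  StarAlgHom.ext fun x => CStarSeminorm.lift_of _ _ (norm_tensorRep_le_minSeminorm r s) x


/-! ### Slice maps -/

/-- Positivity of a linear functional on a `*`-algebra. -/
def IsPositiveFunctional {A : Type*} [Ring A] [StarRing A] [Algebra ℂ A] (ω : A →ₗ[ℂ] ℂ) : Prop :=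
  ∀ a, 0 ≤ ω (star a * a)

/-- The slice map `ω ⊗ id` on the algebraic tensor product. -/
def algSliceLeft (B : Type*) {A : Type*} [Ring A] [Algebra ℂ A] [Ring B] [Algebra ℂ B]
    (ω : A →ₗ[ℂ] ℂ) : A ⊗[ℂ] B →ₗ[ℂ] B :=
  (TensorProduct.lid ℂ B).toLinearMap ∘ₗ ω.rTensor B

/-- The slice map `id ⊗ ω` on the algebraic tensor product. -/
def algSliceRight (A : Type*) {B : Type*} [Ring A] [Algebra ℂ A] [Ring B] [Algebra ℂ B]
    (ω : B →ₗ[ℂ] ℂ) : A ⊗[ℂ] B →ₗ[ℂ] A :=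
  (TensorProduct.rid ℂ A).toLinearMap ∘ₗ ω.lTensor A

theorem algSliceLeft_tmul (ω : A →ₗ[ℂ] ℂ) (a : A) (b : B) :
    algSliceLeft B ω (a ⊗ₜ b) = ω a • b := by
  simp [algSliceLeft]

theorem algSliceRight_tmul (ω : B →ₗ[ℂ] ℂ) (a : A) (b : B) :
    algSliceRight A ω (a ⊗ₜ b) = ω b • a := by
  simp [algSliceRight]

/-- An operator `T` with `⟪k, T k'⟫ = ⟪V k, S (V k')⟫` and `‖V k‖ = c ‖k‖` has norm at most
`c ^ 2 * ‖S‖`. -/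
theorem norm_le_of_compression {H K : Type*} [NormedAddCommGroup H] [InnerProductSpace ℂ H]
    [NormedAddCommGroup K] [InnerProductSpace ℂ K] (V : K → H) (c : ℝ)
    (hV : ∀ k, ‖V k‖ = c * ‖k‖) (S : H →L[ℂ] H) (T : K →L[ℂ] K)
    (h : ∀ k k', inner ℂ k (T k') = inner ℂ (V k) (S (V k'))) : ‖T‖ ≤ c ^ 2 * ‖S‖ := by
  refine ContinuousLinearMap.opNorm_le_bound _ (by positivity) fun k => ?_
  have h1 : ‖T k‖ ^ 2 ≤ ‖V (T k)‖ * (‖S‖ * ‖V k‖) := by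
    have e : (‖T k‖ ^ 2 : ℝ) = ‖(inner ℂ (T k) (T k) : ℂ)‖ := by
      rw [inner_self_eq_norm_sq_to_K]
      simp
    rw [e, h]
    exact (norm_inner_le_norm _ _).trans
      (mul_le_mul_of_nonneg_left (S.le_opNorm _) (norm_nonneg _))
  rw [hV, hV] at h1
  rcases (norm_nonneg (T k)).eq_or_lt with h0 | h0
  · rw [← h0]
    positivity
  · have : ‖T k‖ * ‖T k‖ ≤ ‖T k‖ * (c ^ 2 * ‖S‖ * ‖k‖) := by nlinarith
    exact le_of_mul_le_mul_left this h0

theorem norm_algSliceLeft_le (ω : A →ₗ[ℂ] ℂ) (hω : IsPositiveFunctional ω) (x : A ⊗[ℂ] B) :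
    ‖algSliceLeft B ω x‖ ≤ (ω 1).re * (minSeminorm A B).toFun x := by
  obtain ⟨H, _, _, _, π, ξ, hξ⟩ := CStarAlgebra.exists_gns ω hω
  have hc : ‖ξ‖ ^ 2 = (ω 1).re := by
    have := hξ 1
    rw [map_one, one_apply_eq_self, inner_self_eq_ofReal] at this
    rw [← this, Complex.ofReal_re]
  have h0 : 0 ≤ (minSeminorm A B).toFun x := CStarSeminorm.nonneg' _ _
  rw [← hc]
  refine CStarAlgebra.norm_le_of_forall_rep _ _ (by positivity) fun s => ?_
  refine (norm_le_of_compression (fun k => HilbertTensor.of H s.Space (ξ ⊗ₜ k)) ‖ξ‖ (fun k => ?_)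
    (tensorRep π s.hom x) _ fun k k' => ?_).trans (mul_le_mul_of_nonneg_left
      (norm_tensorRep_le_minSeminorm ⟨H, π⟩ s x) (by positivity))
  · rw [LinearIsometry.norm_map, TensorProduct.norm_tmul]
  · induction x using TensorProduct.induction_on with
    | zero => simp
    | add x y hx hy =>
      simp only [map_add, add_apply, inner_add_right] at *
      rw [hx (CStarSeminorm.nonneg' _ _), hy (CStarSeminorm.nonneg' _ _)]
    | tmul a b =>
      rw [tensorRep_tmul, opTensor_of, LinearIsometry.inner_map_map, TensorProduct.mapL_tmul,
        TensorProduct.inner_tmul, hξ, algSliceLeft_tmul, map_smul, smul_apply, inner_smul_right]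

theorem norm_algSliceRight_le (ω : B →ₗ[ℂ] ℂ) (hω : IsPositiveFunctional ω) (x : A ⊗[ℂ] B) :
    ‖algSliceRight A ω x‖ ≤ (ω 1).re * (minSeminorm A B).toFun x := by
  obtain ⟨H, _, _, _, π, ξ, hξ⟩ := CStarAlgebra.exists_gns ω hω
  have hc : ‖ξ‖ ^ 2 = (ω 1).re := by
    have := hξ 1
    rw [map_one, one_apply_eq_self, inner_self_eq_ofReal] at this
    rw [← this, Complex.ofReal_re]
  have h0 : 0 ≤ (minSeminorm A B).toFun x := CStarSeminorm.nonneg' _ _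
  rw [← hc]
  refine CStarAlgebra.norm_le_of_forall_rep _ _ (by positivity) fun s => ?_
  refine (norm_le_of_compression (fun k => HilbertTensor.of s.Space H (k ⊗ₜ ξ)) ‖ξ‖ (fun k => ?_)
    (tensorRep s.hom π x) _ fun k k' => ?_).trans (mul_le_mul_of_nonneg_left
      (norm_tensorRep_le_minSeminorm s ⟨H, π⟩ x) (by positivity))
  · rw [LinearIsometry.norm_map, TensorProduct.norm_tmul, mul_comm]
  · induction x using TensorProduct.induction_on with
    | zero => simp
    | add x y hx hy =>
      simp only [map_add, add_apply, inner_add_right] at *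
      rw [hx (CStarSeminorm.nonneg' _ _), hy (CStarSeminorm.nonneg' _ _)]
    | tmul a b =>
      rw [tensorRep_tmul, opTensor_of, LinearIsometry.inner_map_map, TensorProduct.mapL_tmul,
        TensorProduct.inner_tmul, hξ, algSliceRight_tmul, map_smul, smul_apply, inner_smul_right,
        mul_comm]

/-- The slice map `ω ⊗ id : A ⊗ B → B` of a positive functional `ω` on `A`: the continuous linear
map with `(ω ⊗ id)(a ⊗ b) = ω(a) b`. -/
def MinTensor.sliceLeft (B : Type u) [CStarAlgebra B] (ω : A →ₗ[ℂ] ℂ)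
    (hω : IsPositiveFunctional ω) : A ⊗ₘ B →L[ℂ] B :=
  (minSeminorm A B).liftL (algSliceLeft B ω) (ω 1).re (norm_algSliceLeft_le ω hω)

/-- The slice map `id ⊗ ω : A ⊗ B → A` of a positive functional `ω` on `B`: the continuous linear
map with `(id ⊗ ω)(a ⊗ b) = ω(b) a`. -/
def MinTensor.sliceRight (A : Type u) [CStarAlgebra A] (ω : B →ₗ[ℂ] ℂ)
    (hω : IsPositiveFunctional ω) : A ⊗ₘ B →L[ℂ] A :=
  (minSeminorm A B).liftL (algSliceRight A ω) (ω 1).re (norm_algSliceRight_le ω hω)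

theorem MinTensor.sliceLeft_tmul (ω : A →ₗ[ℂ] ℂ) (hω : IsPositiveFunctional ω) (a : A) (b : B) :
    MinTensor.sliceLeft B ω hω (MinTensor.of A B (a ⊗ₜ b)) = ω a • b :=
  (CStarSeminorm.liftL_of _ _ _ (norm_algSliceLeft_le ω hω) _).trans (algSliceLeft_tmul ω a b)

theorem MinTensor.sliceRight_tmul (ω : B →ₗ[ℂ] ℂ) (hω : IsPositiveFunctional ω) (a : A) (b : B) :
    MinTensor.sliceRight A ω hω (MinTensor.of A B (a ⊗ₜ b)) = ω b • a :=
  (CStarSeminorm.liftL_of _ _ _ (norm_algSliceRight_le ω hω) _).trans (algSliceRight_tmul ω a b)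

theorem isPositiveFunctional_character (ε : A →⋆ₐ[ℂ] ℂ) :
    IsPositiveFunctional (ε.toAlgHom.toLinearMap) := fun a => by
  change 0 ≤ ε (star a * a)
  rw [map_mul, map_star]
  exact star_mul_self_nonneg (ε a)

/-! ### The tensor product of three algebras -/

variable (A B C) in
theorem bddAbove_tensorRep₃ (x : (A ⊗[ℂ] B) ⊗[ℂ] C) : BddAbove (Set.range
    fun r : HilbertRep A × HilbertRep B × HilbertRep C =>
      ‖tensorRep (tensorRep r.1.hom r.2.1.hom) r.2.2.hom x‖) := by
  induction x using TensorProduct.induction_on with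
  | zero => exact ⟨0, by rintro _ ⟨r, rfl⟩; simp⟩
  | add x y hx hy =>
    obtain ⟨c, hc⟩ := hx
    obtain ⟨d, hd⟩ := hy
    refine ⟨c + d, ?_⟩
    rintro _ ⟨r, rfl⟩
    simp only [map_add]
    exact (norm_add_le _ _).trans (add_le_add (hc ⟨r, rfl⟩) (hd ⟨r, rfl⟩))
  | tmul t b =>
    refine ⟨(minSeminorm A B).toFun t * ‖b‖, ?_⟩
    rintro _ ⟨r, rfl⟩
    exact (norm_opTensor_le _ _).trans (mul_le_mul (norm_tensorRep_le_minSeminorm _ _ _)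
      (NonUnitalStarAlgHom.norm_apply_le _ _) (norm_nonneg _) (CStarSeminorm.nonneg' _ _))

variable (A B C) in
/-- The minimal (spatial) `C*`-norm on the algebraic tensor product of three `C*`-algebras: the
supremum of `‖(π ⊗ ρ ⊗ σ)(x)‖` over all Hilbert space representations `π`, `ρ`, `σ`. -/
def minSeminorm₃ : CStarSeminorm ((A ⊗[ℂ] B) ⊗[ℂ] C) :=
  CStarSeminorm.ofFamily (fun r : HilbertRep A × HilbertRep B × HilbertRep C =>
    tensorRep (tensorRep r.1.hom r.2.1.hom) r.2.2.hom) (bddAbove_tensorRep₃ A B C)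

variable (A B C) in
/-- The (unbracketed) minimal tensor product `A ⊗ B ⊗ C` of three `C*`-algebras. -/
abbrev MinTensor₃ : Type u := (minSeminorm₃ A B C).Completed

variable (A B C) in
/-- The canonical map from the algebraic to the minimal tensor product. -/
abbrev MinTensor₃.of : (A ⊗[ℂ] B) ⊗[ℂ] C →⋆ₐ[ℂ] MinTensor₃ A B C := (minSeminorm₃ A B C).of

/-- A `*`-homomorphism `f : P → T₂` that is contractive for the norm which a `*`-homomorphism
`e : P → T₁` with dense range induces on `P` yields a `*`-homomorphism `T₁ → T₂`. -/
def extendStarHom {P : Type*} [Ring P] [StarRing P] [Algebra ℂ P] {T₁ T₂ : Type*} [CStarAlgebra T₁]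
    [CStarAlgebra T₂] (e : P →⋆ₐ[ℂ] T₁) (he : DenseRange e) (f : P →⋆ₐ[ℂ] T₂)
    (hf : ∀ x, ‖f x‖ ≤ ‖e x‖) : T₁ →⋆ₐ[ℂ] T₂ :=
  let g : T₁ →L[ℂ] T₂ := f.toAlgHom.toLinearMap.extendOfNorm e.toAlgHom.toLinearMap
  have hg : ∀ x, g (e x) = f x :=
    LinearMap.extendOfNorm_eq he ⟨1, fun x => by simpa using hf x⟩
  { toFun := g
    map_one' := by rw [← map_one e, hg, map_one]
    map_mul' := fun x y => by
      refine he.induction_on₂ (p := fun x y => g (x * y) = g x * g y)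
        (isClosed_eq (by fun_prop) (by fun_prop)) (fun x y => ?_) x y
      rw [← map_mul, hg, hg, hg, map_mul]
    map_zero' := map_zero g
    map_add' := map_add g
    commutes' := fun c => by rw [← AlgHomClass.commutes e, hg, AlgHomClass.commutes f]
    map_star' := fun x => by
      refine he.induction_on (p := fun x => g (star x) = star (g x)) x
        (isClosed_eq (g.continuous.comp continuous_star) (continuous_star.comp g.continuous))
        fun x => ?_
      rw [← map_star, hg, hg, map_star] }

theorem extendStarHom_apply {P : Type*} [Ring P] [StarRing P] [Algebra ℂ P] {T₁ T₂ : Type*}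
    [CStarAlgebra T₁] [CStarAlgebra T₂] (e : P →⋆ₐ[ℂ] T₁) (he : DenseRange e) (f : P →⋆ₐ[ℂ] T₂)
    (hf : ∀ x, ‖f x‖ ≤ ‖e x‖) (x : P) : extendStarHom e he f hf (e x) = f x :=
  LinearMap.extendOfNorm_eq (f := f.toAlgHom.toLinearMap) (e := e.toAlgHom.toLinearMap)
    he ⟨1, fun x => by simpa using hf x⟩ x


theorem MinTensor.continuous_of_tmul :
    Continuous fun x : A × B => MinTensor.of A B (x.1 ⊗ₜ x.2) := by
  have h1 : Continuous fun a : A => MinTensor.of A B (a ⊗ₜ 1) :=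
    AddMonoidHomClass.continuous_of_bound
      ((MinTensor.of A B).toAlgHom.toLinearMap ∘ₗ (TensorProduct.mk ℂ A B).flip 1) ‖(1 : B)‖
      fun a => by
        rw [mul_comm]
        exact (CStarSeminorm.norm_of _ _).trans_le (minSeminorm_tmul_le a 1)
  have h2 : Continuous fun b : B => MinTensor.of A B (1 ⊗ₜ b) :=
    AddMonoidHomClass.continuous_of_bound
      ((MinTensor.of A B).toAlgHom.toLinearMap ∘ₗ (TensorProduct.mk ℂ A B) 1) ‖(1 : A)‖
      fun b => (CStarSeminorm.norm_of _ _).trans_le (minSeminorm_tmul_le 1 b)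
  have h3 := (h1.comp continuous_fst).mul (h2.comp (continuous_snd (X := A) (Y := B)))
  convert! h3 using 2 with x
  rw [Pi.mul_apply, Function.comp_apply, Function.comp_apply, ← map_mul, Algebra.TensorProduct.tmul_mul_tmul,
    mul_one, one_mul]

theorem MinTensor.denseRange_of_comp {P Q : Type*} [Ring P] [StarRing P] [Algebra ℂ P]
    [StarModule ℂ P] [Ring Q] [StarRing Q] [Algebra ℂ Q] [StarModule ℂ Q]
    (f : P →⋆ₐ[ℂ] A) (g : Q →⋆ₐ[ℂ] B) (hf : DenseRange f) (hg : DenseRange g) :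
    DenseRange ((MinTensor.of A B).comp (algTensorMap f g)) := by
  let F : P ⊗[ℂ] Q →ₗ[ℂ] A ⊗ₘ B := ((MinTensor.of A B).comp (algTensorMap f g)).toAlgHom.toLinearMap
  let S : Submodule ℂ (A ⊗ₘ B) := (LinearMap.range F).topologicalClosure
  have hS : IsClosed (S : Set (A ⊗ₘ B)) := Submodule.isClosed_topologicalClosure _
  have h1 (x : A × B) : MinTensor.of A B (x.1 ⊗ₜ x.2) ∈ S := by
    refine (hf.prodMap hg).induction_on (p := fun x => MinTensor.of A B (x.1 ⊗ₜ x.2) ∈ S) x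
      (hS.preimage MinTensor.continuous_of_tmul) fun y => ?_
    exact Submodule.le_topologicalClosure _ ⟨y.1 ⊗ₜ y.2, rfl⟩
  have h2 (x : A ⊗[ℂ] B) : MinTensor.of A B x ∈ S := by
    induction x using TensorProduct.induction_on with
    | zero => rw [map_zero]; exact S.zero_mem
    | add x y hx hy => rw [map_add]; exact S.add_mem hx hy
    | tmul a b => exact h1 (a, b)
  intro t
  exact (minSeminorm A B).denseRange_of.induction_on (p := fun t => t ∈ S) t hS h2

variable (A B C) in
/-- The canonical map `(A ⊗ B) ⊗ C → A ⊗ B ⊗ C` from the algebraic tensor product. -/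
def MinTensor.ofLeft : (A ⊗[ℂ] B) ⊗[ℂ] C →⋆ₐ[ℂ] (A ⊗ₘ B) ⊗ₘ C :=
  (MinTensor.of (A ⊗ₘ B) C).comp (algTensorMap (MinTensor.of A B) (StarAlgHom.id ℂ C))

variable (A B C) in
/-- The associator of the algebraic tensor product. -/
def algAssoc : (A ⊗[ℂ] B) ⊗[ℂ] C →⋆ₐ[ℂ] A ⊗[ℂ] (B ⊗[ℂ] C) where
  __ := (Algebra.TensorProduct.assoc ℂ ℂ ℂ A B C).toAlgHom
  map_star' x := by
    change TensorProduct.assoc ℂ A B C (star x) = star (TensorProduct.assoc ℂ A B C x)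
    induction x using TensorProduct.induction_on with
    | zero => simp
    | add x y hx hy => rw [star_add, map_add, map_add, star_add, hx, hy]
    | tmul t c =>
      induction t using TensorProduct.induction_on with
      | zero => simp
      | add x y hx hy =>
        rw [TensorProduct.add_tmul, star_add, map_add, map_add, star_add, hx, hy]
      | tmul a b => rfl

theorem algAssoc_apply (x : (A ⊗[ℂ] B) ⊗[ℂ] C) :
    algAssoc A B C x = TensorProduct.assoc ℂ A B C x := rfl

variable (A B C) in
/-- The canonical map from the algebraic tensor product of three algebras to `A ⊗ (B ⊗ C)`. -/
def MinTensor.ofRight : (A ⊗[ℂ] B) ⊗[ℂ] C →⋆ₐ[ℂ] A ⊗ₘ (B ⊗ₘ C) :=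
  ((MinTensor.of A (B ⊗ₘ C)).comp (algTensorMap (StarAlgHom.id ℂ A) (MinTensor.of B C))).comp
    (algAssoc A B C)

theorem MinTensor.denseRange_ofLeft : DenseRange (MinTensor.ofLeft A B C) :=
  MinTensor.denseRange_of_comp _ _ (CStarSeminorm.denseRange_of _) Function.surjective_id.denseRange

theorem MinTensor.denseRange_ofRight : DenseRange (MinTensor.ofRight A B C) := by
  have h : Function.Surjective (algAssoc A B C) := (TensorProduct.assoc ℂ A B C).surjective
  have h2 := MinTensor.denseRange_of_comp (StarAlgHom.id ℂ A) (MinTensor.of B C)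
    Function.surjective_id.denseRange (CStarSeminorm.denseRange_of _)
  rw [DenseRange, ← h.range_comp] at h2
  exact h2

theorem norm_of₃_le_ofLeft (x : (A ⊗[ℂ] B) ⊗[ℂ] C) :
    ‖MinTensor₃.of A B C x‖ ≤ ‖MinTensor.ofLeft A B C x‖ := by
  rw [CStarSeminorm.norm_of]
  refine Real.iSup_le (fun r => ?_) (norm_nonneg _)
  change ‖tensorRep (tensorRep r.1.hom r.2.1.hom) r.2.2.hom x‖ ≤ _
  rw [← MinTensor.rep_comp_of r.1 r.2.1]
  have := tensorRep_algTensorMap (MinTensor.rep r.1 r.2.1).hom r.2.2.hom (MinTensor.of A B)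
    (StarAlgHom.id ℂ C) x
  rw [StarAlgHom.comp_id] at this
  refine (congrArg norm this).symm.trans_le ?_
  exact (norm_tensorRep_le_minSeminorm (MinTensor.rep r.1 r.2.1) r.2.2 _).trans_eq
    (CStarSeminorm.norm_of _ _).symm

section Assoc

variable {H K L : Type u}
  [NormedAddCommGroup H] [InnerProductSpace ℂ H] [CompleteSpace H]
  [NormedAddCommGroup K] [InnerProductSpace ℂ K] [CompleteSpace K]
  [NormedAddCommGroup L] [InnerProductSpace ℂ L] [CompleteSpace L]

variable (H K L) in
/-- The canonical isometry `H ⊗ K ⊗ L → (H ⊗ K) ⊗ L` from the algebraic tensor product. -/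
def HilbertTensor.ofLeft : (H ⊗[ℂ] K) ⊗[ℂ] L →ₗᵢ[ℂ] HilbertTensor (HilbertTensor H K) L :=
  (HilbertTensor.of _ L).comp
    (TensorProduct.mapIsometry (HilbertTensor.of H K) LinearIsometry.id)

variable (H K L) in
/-- The canonical isometry `H ⊗ K ⊗ L → H ⊗ (K ⊗ L)` from the algebraic tensor product. -/
def HilbertTensor.ofRight : (H ⊗[ℂ] K) ⊗[ℂ] L →ₗᵢ[ℂ] HilbertTensor H (HilbertTensor K L) :=
  ((HilbertTensor.of H _).comp
    (TensorProduct.mapIsometry LinearIsometry.id (HilbertTensor.of K L))).comp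
    (TensorProduct.assocIsometry ℂ H K L).toLinearIsometry

variable (π : A →⋆ₐ[ℂ] (H →L[ℂ] H)) (ρ : B →⋆ₐ[ℂ] (K →L[ℂ] K)) (σ : C →⋆ₐ[ℂ] (L →L[ℂ] L))

theorem exists_tensorRep_ofLeft_ofRight (x : (A ⊗[ℂ] B) ⊗[ℂ] C) (v : (H ⊗[ℂ] K) ⊗[ℂ] L) :
    ∃ w : (H ⊗[ℂ] K) ⊗[ℂ] L,
      tensorRep (tensorRep π ρ) σ x (HilbertTensor.ofLeft H K L v) = HilbertTensor.ofLeft H K L w ∧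
      tensorRep π (tensorRep ρ σ) (algAssoc A B C x) (HilbertTensor.ofRight H K L v) =
        HilbertTensor.ofRight H K L w := by
  induction v using TensorProduct.induction_on with
  | zero =>
    refine ⟨0, ?_, ?_⟩
    · rw [LinearIsometry.map_zero, ContinuousLinearMap.map_zero]
    · rw [LinearIsometry.map_zero, ContinuousLinearMap.map_zero]
  | add v v' h h' =>
    obtain ⟨w, h1, h2⟩ := h
    obtain ⟨w', h1', h2'⟩ := h'
    refine ⟨w + w', ?_, ?_⟩
    · rw [LinearIsometry.map_add, ContinuousLinearMap.map_add, LinearIsometry.map_add, h1, h1']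
    · rw [LinearIsometry.map_add, ContinuousLinearMap.map_add, LinearIsometry.map_add, h2, h2']
  | tmul y l =>
  induction y using TensorProduct.induction_on with
  | zero =>
    refine ⟨0, ?_, ?_⟩
    · rw [TensorProduct.zero_tmul, LinearIsometry.map_zero, ContinuousLinearMap.map_zero]
    · rw [TensorProduct.zero_tmul, LinearIsometry.map_zero, ContinuousLinearMap.map_zero]
  | add v v' h h' =>
    obtain ⟨w, h1, h2⟩ := h
    obtain ⟨w', h1', h2'⟩ := h'
    refine ⟨w + w', ?_, ?_⟩
    · rw [TensorProduct.add_tmul, LinearIsometry.map_add, ContinuousLinearMap.map_add,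
        LinearIsometry.map_add, h1, h1']
    · rw [TensorProduct.add_tmul, LinearIsometry.map_add, ContinuousLinearMap.map_add,
        LinearIsometry.map_add, h2, h2']
  | tmul h k =>
  induction x using TensorProduct.induction_on with
  | zero =>
    refine ⟨0, ?_, ?_⟩
    · rw [map_zero, zero_apply, LinearIsometry.map_zero]
    · rw [map_zero, map_zero, zero_apply, LinearIsometry.map_zero]
  | add x x' h h' =>
    obtain ⟨w, h1, h2⟩ := h
    obtain ⟨w', h1', h2'⟩ := h'
    refine ⟨w + w', ?_, ?_⟩
    · rw [map_add, add_apply, LinearIsometry.map_add, h1, h1']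
    · rw [map_add, map_add, add_apply, LinearIsometry.map_add, h2, h2']
  | tmul z c =>
  induction z using TensorProduct.induction_on with
  | zero =>
    refine ⟨0, ?_, ?_⟩
    · rw [TensorProduct.zero_tmul, map_zero, zero_apply, LinearIsometry.map_zero]
    · rw [TensorProduct.zero_tmul, map_zero, map_zero, zero_apply, LinearIsometry.map_zero]
  | add x x' h h' =>
    obtain ⟨w, h1, h2⟩ := h
    obtain ⟨w', h1', h2'⟩ := h'
    refine ⟨w + w', ?_, ?_⟩
    · rw [TensorProduct.add_tmul, map_add, add_apply, LinearIsometry.map_add, h1, h1']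
    · rw [TensorProduct.add_tmul, map_add, map_add, add_apply, LinearIsometry.map_add, h2, h2']
  | tmul a b =>
    refine ⟨(π a h ⊗ₜ ρ b k) ⊗ₜ σ c l, ?_, ?_⟩
    · change opTensor (opTensor (π a) (ρ b)) (σ c)
        (HilbertTensor.of _ L (HilbertTensor.of H K (h ⊗ₜ k) ⊗ₜ l)) =
        HilbertTensor.of _ L (HilbertTensor.of H K (π a h ⊗ₜ ρ b k) ⊗ₜ σ c l)
      rw [opTensor_of, TensorProduct.mapL_tmul, opTensor_of, TensorProduct.mapL_tmul]
    · change opTensor (π a) (opTensor (ρ b) (σ c))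
        (HilbertTensor.of H _ (h ⊗ₜ HilbertTensor.of K L (k ⊗ₜ l))) =
        HilbertTensor.of H _ (π a h ⊗ₜ HilbertTensor.of K L (ρ b k ⊗ₜ σ c l))
      rw [opTensor_of, TensorProduct.mapL_tmul, opTensor_of, TensorProduct.mapL_tmul]

theorem norm_tensorRep_assoc (x : (A ⊗[ℂ] B) ⊗[ℂ] C) : ‖tensorRep (tensorRep π ρ) σ x‖ ≤
    ‖tensorRep π (tensorRep ρ σ) (algAssoc A B C x)‖ := by
  have hd : DenseRange (HilbertTensor.ofLeft H K L) :=
    HilbertTensor.denseRange_of_comp _ HilbertTensor.denseRange_of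
  refine ContinuousLinearMap.opNorm_le_bound _ (norm_nonneg _) fun u => ?_
  refine hd.induction_on (p := fun u => ‖tensorRep (tensorRep π ρ) σ x u‖ ≤
      ‖tensorRep π (tensorRep ρ σ) (algAssoc A B C x)‖ * ‖u‖) u
    (isClosed_le (by fun_prop) (by fun_prop)) fun v => ?_
  obtain ⟨w, h1, h2⟩ := exists_tensorRep_ofLeft_ofRight π ρ σ x v
  rw [h1, LinearIsometry.norm_map, LinearIsometry.norm_map,
    ← (HilbertTensor.ofRight H K L).norm_map w, ← h2, ← (HilbertTensor.ofRight H K L).norm_map v]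
  exact ContinuousLinearMap.le_opNorm _ _

end Assoc

theorem norm_of₃_le_ofRight (x : (A ⊗[ℂ] B) ⊗[ℂ] C) :
    ‖MinTensor₃.of A B C x‖ ≤ ‖MinTensor.ofRight A B C x‖ := by
  rw [CStarSeminorm.norm_of]
  refine Real.iSup_le (fun r => ?_) (norm_nonneg _)
  refine (norm_tensorRep_assoc r.1.hom r.2.1.hom r.2.2.hom x).trans ?_
  rw [← MinTensor.rep_comp_of r.2.1 r.2.2]
  have := tensorRep_algTensorMap r.1.hom (MinTensor.rep r.2.1 r.2.2).hom
    (StarAlgHom.id ℂ A) (MinTensor.of B C) (algAssoc A B C x)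
  rw [StarAlgHom.comp_id] at this
  refine (congrArg norm this).symm.trans_le ?_
  exact (norm_tensorRep_le_minSeminorm r.1 (MinTensor.rep r.2.1 r.2.2) _).trans_eq
    (CStarSeminorm.norm_of _ _).symm

variable (A B C) in
/-- The canonical map `(A ⊗ B) ⊗ C → A ⊗ B ⊗ C`, which removes the brackets. -/
def MinTensor.unbracketLeft : (A ⊗ₘ B) ⊗ₘ C →⋆ₐ[ℂ] MinTensor₃ A B C :=
  extendStarHom (MinTensor.ofLeft A B C) MinTensor.denseRange_ofLeft (MinTensor₃.of A B C)
    norm_of₃_le_ofLeft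

variable (A B C) in
/-- The canonical map `A ⊗ (B ⊗ C) → A ⊗ B ⊗ C`, which removes the brackets. -/
def MinTensor.unbracketRight : A ⊗ₘ (B ⊗ₘ C) →⋆ₐ[ℂ] MinTensor₃ A B C :=
  extendStarHom (MinTensor.ofRight A B C) MinTensor.denseRange_ofRight (MinTensor₃.of A B C)
    norm_of₃_le_ofRight

theorem MinTensor.unbracketLeft_ofLeft (x : (A ⊗[ℂ] B) ⊗[ℂ] C) :
    MinTensor.unbracketLeft A B C (MinTensor.ofLeft A B C x) = MinTensor₃.of A B C x :=
  extendStarHom_apply _ _ _ norm_of₃_le_ofLeft x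

theorem MinTensor.unbracketRight_ofRight (x : (A ⊗[ℂ] B) ⊗[ℂ] C) :
    MinTensor.unbracketRight A B C (MinTensor.ofRight A B C x) = MinTensor₃.of A B C x :=
  extendStarHom_apply _ _ _ norm_of₃_le_ofRight x

end MinTensor

/-! ### Quantum families of maps

A compact quantum space is given by its unital `C*`-algebra of functions; below `X`, `Y`, `M`,
`D`, `E`, `W`, … stand for the algebras `C(𝕏)`, `C(𝕐)`, `C(𝕄)`, …. -/

section QuantumFamilies

/-- A quantum family of maps `𝕏 → 𝕐` parametrized by `𝔻`: a unital `*`-homomorphism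
`C(𝕐) → C(𝕏) ⊗ C(𝔻)`. -/
abbrev QuantumFamily (X Y D : Type u) [CStarAlgebra X] [CStarAlgebra Y] [CStarAlgebra D] : Type u :=
  Y →⋆ₐ[ℂ] X ⊗ₘ D

variable {X Y X₁ X₂ X₃ D D₁ D₂ E M W : Type u} [CStarAlgebra X] [CStarAlgebra Y]
  [CStarAlgebra X₁] [CStarAlgebra X₂] [CStarAlgebra X₃] [CStarAlgebra D] [CStarAlgebra D₁]
  [CStarAlgebra D₂] [CStarAlgebra E] [CStarAlgebra M] [CStarAlgebra W]

/-- The family `(id ⊗ Λ) ∘ Φ` obtained from `Φ` by a change of parameters `Λ`. -/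
def changeParameter (Φ : QuantumFamily X Y E) (Λ : E →⋆ₐ[ℂ] D) : QuantumFamily X Y D :=
  (MinTensor.map (StarAlgHom.id ℂ X) Λ).comp Φ

/-- The composition `Ψ₁ △ Ψ₂ = (Ψ₁ ⊗ id) ∘ Ψ₂` of quantum families, with values in the tensor
product of three algebras. -/
def composeFamilies (Ψ₁ : QuantumFamily X₁ X₂ D₁) (Ψ₂ : QuantumFamily X₂ X₃ D₂) :
    X₃ →⋆ₐ[ℂ] MinTensor₃ X₁ D₁ D₂ :=
  (MinTensor.unbracketLeft X₁ D₁ D₂).comp ((MinTensor.map Ψ₁ (StarAlgHom.id ℂ D₂)).comp Ψ₂)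

/-- `Φ` is the quantum family of all maps `𝕏 → 𝕐`. -/
def IsFamilyOfAllMaps (Φ : QuantumFamily X Y E) : Prop :=
  ∀ (D : Type u) [CStarAlgebra D] (Ψ : QuantumFamily X Y D),
    ∃! Λ : E →⋆ₐ[ℂ] D, changeParameter Φ Λ = Ψ

/-- States: positive functionals of norm one. -/
structure IsState (ω : M →L[ℂ] ℂ) : Prop where
  norm_eq_one : ‖ω‖ = 1
  nonneg : ∀ a, 0 ≤ ω (star a * a)

theorem IsState.isPositiveFunctional {ω : M →L[ℂ] ℂ} (hω : IsState ω) :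
    IsPositiveFunctional ω.toLinearMap := hω.nonneg

/-- The quantum family `Ψ` preserves the state `ω`: `(ω ⊗ id)(Ψ x) = ω(x) 1` for all `x`. -/
def PreservesState (Ψ : QuantumFamily M M D) (ω : M →L[ℂ] ℂ) (hω : IsState ω) : Prop :=
  ∀ x, MinTensor.sliceLeft D ω.toLinearMap hω.isPositiveFunctional (Ψ x) = ω x • (1 : D)

/-- Every quantum family that preserves `ω` arises from `Φ` by a unique change of parameters. -/
def ClassifiesPreserving (Φ : QuantumFamily M M W) (ω : M →L[ℂ] ℂ) (hω : IsState ω) : Prop :=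
  ∀ (D : Type u) [CStarAlgebra D] (Ψ : QuantumFamily M M D), PreservesState Ψ ω hω →
    ∃! Λ : W →⋆ₐ[ℂ] D, changeParameter Φ Λ = Ψ

/-! ### Compact quantum semigroups -/

/-- Coassociativity: `(Δ ⊗ id) ∘ Δ = (id ⊗ Δ) ∘ Δ` as maps into `C(𝕎) ⊗ C(𝕎) ⊗ C(𝕎)`. -/
def IsCoassociative (Δ : W →⋆ₐ[ℂ] W ⊗ₘ W) : Prop :=
  (MinTensor.unbracketLeft W W W).comp ((MinTensor.map Δ (StarAlgHom.id ℂ W)).comp Δ) =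
    (MinTensor.unbracketRight W W W).comp ((MinTensor.map (StarAlgHom.id ℂ W) Δ).comp Δ)

/-- The character `ε` is a counit for `Δ`: `(ε ⊗ id) ∘ Δ = (id ⊗ ε) ∘ Δ = id`. -/
def IsCounit (Δ : W →⋆ₐ[ℂ] W ⊗ₘ W) (ε : W →⋆ₐ[ℂ] ℂ) : Prop :=
  ∀ a, MinTensor.sliceLeft W _ (isPositiveFunctional_character ε) (Δ a) = a ∧
    MinTensor.sliceRight W _ (isPositiveFunctional_character ε) (Δ a) = a

/-- `Δ` is the comultiplication of a compact quantum semigroup with unit. -/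
def IsQuantumSemigroupWithUnit (Δ : W →⋆ₐ[ℂ] W ⊗ₘ W) : Prop :=
  IsCoassociative Δ ∧ ∃ ε : W →⋆ₐ[ℂ] ℂ, IsCounit Δ ε

/-- `Φ △ Φ = (id ⊗ Δ) ∘ Φ`: the comultiplication `Δ` encodes the composition of the family `Φ`
with itself. -/
def EncodesComposition (Φ : QuantumFamily M M E) (Δ : E →⋆ₐ[ℂ] E ⊗ₘ E) : Prop :=
  composeFamilies Φ Φ =
    (MinTensor.unbracketRight M E E).comp (changeParameter Φ Δ)

/-- `Λ` intertwines the comultiplications: `(Λ ⊗ Λ) ∘ Δ₁ = Δ₂ ∘ Λ`. -/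
def Intertwines (Λ : E →⋆ₐ[ℂ] W) (Δ₁ : E →⋆ₐ[ℂ] E ⊗ₘ E) (Δ₂ : W →⋆ₐ[ℂ] W ⊗ₘ W) : Prop :=
  (MinTensor.map Λ Λ).comp Δ₁ = Δ₂.comp Λ

end QuantumFamilies

end

/-!
Let `e` be a basis of the finite-dimensional algebra `M = C(𝕄)`. A quantum family
`Ψ : M → M ⊗ D` is determined by its matrix coefficients `u i j ∈ D`, where
`Ψ (e j) = ∑ i, e i ⊗ u i j`; they are slices of `Ψ (e j)` by the coordinate functionals. Everything
is expressed in these coefficients: a change of parameters `Λ` applies `Λ` to them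
(`changeParameter_eq_iff`), preservation of `ω` is the linear relation
`∑ i, ω(e i) u i j = ω(e j) 1` (`preservesState_iff`), and `Δ` encodes the composition exactly if
`Δ (u i j) = ∑ k, u i k ⊗ u k j` (`encodesComposition_iff_coef`).

The analytic input is that slice maps `f ⊗ id` by arbitrary functionals `f` of `M` are bounded on
the minimal tensor product, with a bound independent of the second factor (`isSliceBounded`). For a
positive functional this is a compression in its GNS representation, and the functionals `φ (b ·)`
with `φ` positive span the dual of `M`. Consequently the algebraic and the minimal tensor product
of `M` with `D` coincide (`MinTensor.bijective_of`), coefficients are bounded uniformly over all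
families, and `M ⊗ (E ⊗ E) → M ⊗ E ⊗ E` is injective (`MinTensor.injective_unbracketRight`).

The algebra `C(𝕎)` is the completion of the free `*`-algebra on a matrix of generators with respect
to the supremum of the seminorms which all `ω`-preserving families induce. A relation between
generators that holds in every such family holds in `C(𝕎)`, so that the generic family is a
`*`-homomorphism, preserves `ω` and classifies the families preserving `ω`
(`classifiesPreserving_universalFamily`). A `*`-homomorphism on `C(𝕎)` is determined by its values
on the coefficients. The comultiplication classifies the composition of the universal family with
itself, the counit classifies the family that consists of the identity map only, and
coassociativity, the counit laws and the intertwining relation are identities of matrix products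
that are checked on coefficients.
-/

noncomputable section

/-! ### Slice maps of arbitrary functionals on a finite-dimensional algebra -/

section Slice

variable {A B C : Type u} [CStarAlgebra A] [CStarAlgebra B] [CStarAlgebra C]

theorem continuous_starAlgHom (f : A →⋆ₐ[ℂ] B) : Continuous f :=
  AddMonoidHomClass.continuous_of_bound f 1 fun a => by
    rw [one_mul]
    exact NonUnitalStarAlgHom.norm_apply_le f a

/-- `f` is slice-bounded if `f ⊗ id` is bounded, with a constant that depends on `f` only, for the
norms which Hilbert space representations induce on algebraic tensor products. -/
def IsSliceBounded (f : A →ₗ[ℂ] ℂ) : Prop :=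
  ∃ k : ℝ, 0 ≤ k ∧ ∀ (Q : Type u) [Ring Q] [StarRing Q] [Algebra ℂ Q] [StarModule ℂ Q]
    (K : Type u) [NormedAddCommGroup K] [InnerProductSpace ℂ K] [CompleteSpace K]
    (ρ : Q →⋆ₐ[ℂ] (K →L[ℂ] K)) (x : A ⊗[ℂ] Q) (c : ℝ), 0 ≤ c →
    (∀ r : HilbertRep A, ‖tensorRep r.hom ρ x‖ ≤ c) → ‖ρ (algSliceLeft Q f x)‖ ≤ k * c

/-- Like `algSliceLeft_tmul`, without a norm on the algebras. -/
theorem algSliceLeft_tmul_of_ring {P Q : Type*} [Ring P] [Algebra ℂ P] [Ring Q] [Algebra ℂ Q]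
    (f : P →ₗ[ℂ] ℂ) (a : P) (b : Q) : algSliceLeft Q f (a ⊗ₜ b) = f a • b := by
  simp [algSliceLeft]

theorem IsSliceBounded.add {f g : A →ₗ[ℂ] ℂ} (hf : IsSliceBounded f) (hg : IsSliceBounded g) :
    IsSliceBounded (f + g) := by
  obtain ⟨k, hk, h⟩ := hf
  obtain ⟨l, hl, h'⟩ := hg
  refine ⟨k + l, add_nonneg hk hl, fun Q _ _ _ _ K _ _ _ ρ x c hc hx => ?_⟩
  have e : algSliceLeft Q (f + g) x = algSliceLeft Q f x + algSliceLeft Q g x := by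
    simp [algSliceLeft, LinearMap.rTensor_add]
  rw [e, map_add, add_mul]
  exact (norm_add_le _ _).trans (add_le_add (h Q K ρ x c hc hx) (h' Q K ρ x c hc hx))

theorem IsSliceBounded.smul {f : A →ₗ[ℂ] ℂ} (hf : IsSliceBounded f) (z : ℂ) :
    IsSliceBounded (z • f) := by
  obtain ⟨k, hk, h⟩ := hf
  refine ⟨‖z‖ * k, by positivity, fun Q _ _ _ _ K _ _ _ ρ x c hc hx => ?_⟩
  have e : algSliceLeft Q (z • f) x = z • algSliceLeft Q f x := by
    simp [algSliceLeft, LinearMap.rTensor_smul]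
  rw [e, map_smul, norm_smul, mul_assoc]
  exact mul_le_mul_of_nonneg_left (h Q K ρ x c hc hx) (norm_nonneg z)

theorem IsSliceBounded.zero : IsSliceBounded (0 : A →ₗ[ℂ] ℂ) := by
  refine ⟨0, le_rfl, fun Q _ _ _ _ K _ _ _ ρ x c hc hx => ?_⟩
  simp [algSliceLeft]

/-- If `φ` is the vector functional of `ξ` in a representation `π`, then the slice by `φ (b ·)` is
the compression of `(b ⊗ 1) x` to the vectors `ξ ⊗ k`. -/
theorem IsPositiveFunctional.isSliceBounded_mulLeft {φ : A →ₗ[ℂ] ℂ} (hφ : IsPositiveFunctional φ)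
    (b : A) : IsSliceBounded (φ ∘ₗ LinearMap.mulLeft ℂ b) := by
  obtain ⟨H, _, _, _, π, ξ, hξ⟩ := CStarAlgebra.exists_gns φ hφ
  refine ⟨‖ξ‖ ^ 2 * ‖b‖, by positivity, fun Q _ _ _ _ K _ _ _ ρ x c hc hx => ?_⟩
  have hb : ‖tensorRep π ρ (b ⊗ₜ 1 * x)‖ ≤ ‖b‖ * c := by
    rw [map_mul]
    refine (norm_mul_le _ _).trans
      (mul_le_mul ?_ (hx ⟨H, π⟩) (norm_nonneg _) (norm_nonneg _))
    rw [tensorRep_tmul, map_one]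
    refine (norm_opTensor_le _ _).trans ?_
    refine (mul_le_mul (NonUnitalStarAlgHom.norm_apply_le π b) ContinuousLinearMap.norm_id_le
      (norm_nonneg _) (norm_nonneg _)).trans_eq (mul_one _)
  have key := norm_le_of_compression (fun k => HilbertTensor.of H K (ξ ⊗ₜ k)) ‖ξ‖ (fun k => by
    rw [LinearIsometry.norm_map, TensorProduct.norm_tmul]) (tensorRep π ρ (b ⊗ₜ 1 * x))
    (ρ (algSliceLeft Q (φ ∘ₗ LinearMap.mulLeft ℂ b) x)) fun k k' => by
      clear hx hb
      induction x using TensorProduct.induction_on with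
      | zero => simp
      | add x y hx hy =>
        rw [mul_add, map_add, map_add, map_add, add_apply, add_apply,
          inner_add_right, inner_add_right, hx, hy]
      | tmul a q =>
        rw [Algebra.TensorProduct.tmul_mul_tmul, one_mul, tensorRep_tmul, opTensor_of,
          LinearIsometry.inner_map_map, TensorProduct.mapL_tmul, TensorProduct.inner_tmul, hξ,
          algSliceLeft_tmul_of_ring, map_smul, smul_apply, inner_smul_right]
        rfl
  rw [mul_assoc]
  exact key.trans (mul_le_mul_of_nonneg_left hb (by positivity))

/-- On a finite-dimensional algebra the functionals `φ (b ·)` with `φ` positive span the dual: an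
element `a` on which all of them vanish satisfies `φ (a* a) = 0` for all positive `φ`. -/
theorem isSliceBounded [FiniteDimensional ℂ A] (f : A →ₗ[ℂ] ℂ) : IsSliceBounded f := by
  let S : Submodule ℂ (Module.Dual ℂ A) :=
    { carrier := {f | IsSliceBounded f}
      add_mem' := fun hf hg => hf.add hg
      zero_mem' := IsSliceBounded.zero
      smul_mem' := fun z _ hf => hf.smul z }
  have hS : S.dualCoannihilator = ⊥ := by
    rw [eq_bot_iff]
    intro a ha
    rw [Submodule.mem_dualCoannihilator] at ha
    by_contra hne
    have : Nontrivial A := ⟨a, 0, hne⟩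
    obtain ⟨φ, hφ, -, h2⟩ := CStarAlgebra.exists_positive_functional a
    have h3 := ha _ (IsPositiveFunctional.isSliceBounded_mulLeft hφ (star a))
    have h4 : φ (star a * a) = 0 := h3
    rw [h2] at h4
    refine hne ?_
    simpa using h4
  have : S = ⊤ := by
    rw [← Subspace.dualCoannihilator_dualAnnihilator_eq (W := S), hS,
      Submodule.dualAnnihilator_bot]
  have hf : f ∈ S := this ▸ Submodule.mem_top
  exact hf

theorem MinTensor.clm_ext {F : Type*} [NormedAddCommGroup F] [NormedSpace ℂ F]
    {S T : A ⊗ₘ B →L[ℂ] F}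
    (h : ∀ a b, S (MinTensor.of A B (a ⊗ₜ b)) = T (MinTensor.of A B (a ⊗ₜ b))) : S = T := by
  ext t
  refine (minSeminorm A B).denseRange_of.induction_on (p := fun t => S t = T t) t
    (isClosed_eq S.continuous T.continuous) fun x => ?_
  induction x using TensorProduct.induction_on with
  | zero => rw [map_zero, map_zero, map_zero]
  | add x y hx hy => rw [map_add, map_add, map_add, hx, hy]
  | tmul a b => exact h a b

theorem sum_algSliceLeft {ι Q : Type*} [Fintype ι] [Ring Q] [Algebra ℂ Q] (e : Module.Basis ι ℂ A)
    (x : A ⊗[ℂ] Q) : ∑ i, e i ⊗ₜ algSliceLeft Q (e.coord i) x = x := by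
  induction x using TensorProduct.induction_on with
  | zero => simp
  | add x y hx hy => simp only [map_add, TensorProduct.tmul_add, Finset.sum_add_distrib, hx, hy]
  | tmul a b =>
    simp only [algSliceLeft_tmul_of_ring, TensorProduct.tmul_smul, TensorProduct.smul_tmul']
    rw [← TensorProduct.sum_tmul]
    simp only [Module.Basis.coord_apply, e.sum_repr]

variable [FiniteDimensional ℂ A]

/-- The constant `k` is chosen before `B`, so that it is uniform in the second factor. -/
theorem exists_norm_algSliceLeft_le (f : A →ₗ[ℂ] ℂ) : ∃ k : ℝ, 0 ≤ k ∧
    ∀ (B : Type u) [CStarAlgebra B] (x : A ⊗[ℂ] B),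
      ‖algSliceLeft B f x‖ ≤ k * (minSeminorm A B).toFun x := by
  obtain ⟨k, hk, h⟩ := isSliceBounded f
  refine ⟨k, hk, fun B _ x => ?_⟩
  have h0 := (minSeminorm A B).nonneg' x
  exact CStarAlgebra.norm_le_of_forall_rep _ _ (by positivity) fun s =>
    h B s.Space s.hom x _ h0 fun r => norm_tensorRep_le_minSeminorm r s x

/-- The norm of the slice map `f ⊗ id` is at most this constant, whatever the second factor. -/
def sliceBound (f : A →ₗ[ℂ] ℂ) : ℝ := (exists_norm_algSliceLeft_le f).choose

theorem sliceBound_nonneg (f : A →ₗ[ℂ] ℂ) : 0 ≤ sliceBound f :=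
  (exists_norm_algSliceLeft_le f).choose_spec.1

theorem norm_algSliceLeft_le_sliceBound (f : A →ₗ[ℂ] ℂ) (x : A ⊗[ℂ] B) :
    ‖algSliceLeft B f x‖ ≤ sliceBound f * (minSeminorm A B).toFun x :=
  (exists_norm_algSliceLeft_le f).choose_spec.2 B x

/-- The slice map `f ⊗ id : A ⊗ B → B` of an arbitrary functional `f` on the finite-dimensional
algebra `A`. -/
def MinTensor.slice (B : Type u) [CStarAlgebra B] (f : A →ₗ[ℂ] ℂ) : A ⊗ₘ B →L[ℂ] B :=
  (minSeminorm A B).liftL (algSliceLeft B f) (sliceBound f) (norm_algSliceLeft_le_sliceBound f)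

theorem MinTensor.slice_of (f : A →ₗ[ℂ] ℂ) (x : A ⊗[ℂ] B) :
    MinTensor.slice B f (MinTensor.of A B x) = algSliceLeft B f x :=
  CStarSeminorm.liftL_of _ _ _ (norm_algSliceLeft_le_sliceBound f) x

theorem MinTensor.slice_of_tmul (f : A →ₗ[ℂ] ℂ) (a : A) (b : B) :
    MinTensor.slice B f (MinTensor.of A B (a ⊗ₜ b)) = f a • b := by
  rw [MinTensor.slice_of, algSliceLeft_tmul]

theorem MinTensor.norm_slice_le (f : A →ₗ[ℂ] ℂ) (t : A ⊗ₘ B) :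
    ‖MinTensor.slice B f t‖ ≤ sliceBound f * ‖t‖ := by
  refine (minSeminorm A B).denseRange_of.induction_on
    (p := fun t => ‖MinTensor.slice B f t‖ ≤ sliceBound f * ‖t‖) t
    (isClosed_le (by fun_prop) (by fun_prop)) fun x => ?_
  rw [CStarSeminorm.norm_of]
  exact (congrArg norm (MinTensor.slice_of f x)).trans_le (norm_algSliceLeft_le_sliceBound f x)

section Basis

variable {ι : Type*} [Fintype ι] (e : Module.Basis ι ℂ A)

/-- Every element of `A ⊗ B` is the sum of the elementary tensors of its coordinates: this holds
on elementary tensors, and both sides are continuous. -/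
theorem MinTensor.sum_of_slice (t : A ⊗ₘ B) :
    ∑ i, MinTensor.of A B (e i ⊗ₜ MinTensor.slice B (e.coord i) t) = t := by
  have hc (a : A) : Continuous fun b : B => MinTensor.of A B (a ⊗ₜ b) :=
    MinTensor.continuous_of_tmul.comp (Continuous.prodMk continuous_const continuous_id)
  let T : A ⊗ₘ B →L[ℂ] A ⊗ₘ B :=
    ∑ i, (⟨(MinTensor.of A B).toAlgHom.toLinearMap ∘ₗ TensorProduct.mk ℂ A B (e i), hc (e i)⟩ :
      B →L[ℂ] A ⊗ₘ B) ∘L MinTensor.slice B (e.coord i)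
  have hT (t : A ⊗ₘ B) :
      T t = ∑ i, MinTensor.of A B (e i ⊗ₜ MinTensor.slice B (e.coord i) t) := by
    simp only [T, sum_apply]
    rfl
  have : T = ContinuousLinearMap.id ℂ _ := MinTensor.clm_ext fun a b => by
    rw [hT]
    simp only [MinTensor.slice_of_tmul, TensorProduct.tmul_smul, TensorProduct.smul_tmul']
    rw [← map_sum, ← TensorProduct.sum_tmul]
    simp only [Module.Basis.coord_apply, e.sum_repr]
    rfl
  rw [← hT, this]
  rfl

variable {e} in
theorem MinTensor.ext_slice {t t' : A ⊗ₘ B}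
    (h : ∀ i, MinTensor.slice B (e.coord i) t = MinTensor.slice B (e.coord i) t') : t = t' := by
  rw [← MinTensor.sum_of_slice e t, ← MinTensor.sum_of_slice e t']
  simp only [h]

theorem MinTensor.slice_sum_of [DecidableEq ι] (d : ι → B) (i : ι) :
    MinTensor.slice B (e.coord i) (∑ k, MinTensor.of A B (e k ⊗ₜ d k)) = d i := by
  rw [map_sum]
  simp [MinTensor.slice_of_tmul, Finsupp.single_apply]

end Basis

/-- The algebraic tensor product with a finite-dimensional algebra is already complete, and the
minimal seminorm is a norm on it. -/
theorem MinTensor.bijective_of : Function.Bijective (MinTensor.of A B) := by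
  let e := Module.finBasis ℂ A
  refine ⟨(injective_iff_map_eq_zero (MinTensor.of A B)).2 fun x hx => ?_, fun t =>
    ⟨∑ i, e i ⊗ₜ MinTensor.slice B (e.coord i) t, by
      rw [map_sum, MinTensor.sum_of_slice e t]⟩⟩
  rw [← sum_algSliceLeft e x]
  refine Finset.sum_eq_zero fun i _ => ?_
  rw [← MinTensor.slice_of, hx, map_zero, TensorProduct.tmul_zero]

end Slice

/-! ### Removing brackets is injective when the first factor is finite-dimensional -/

section Unbracket

variable {A B C : Type u} [CStarAlgebra A] [CStarAlgebra B] [CStarAlgebra C]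

theorem HilbertTensor.denseRange_ofRight {H K L : Type u}
    [NormedAddCommGroup H] [InnerProductSpace ℂ H] [CompleteSpace H]
    [NormedAddCommGroup K] [InnerProductSpace ℂ K] [CompleteSpace K]
    [NormedAddCommGroup L] [InnerProductSpace ℂ L] [CompleteSpace L] :
    DenseRange (HilbertTensor.ofRight H K L) := by
  let S : Submodule ℂ (HilbertTensor H (HilbertTensor K L)) :=
    (LinearMap.range (HilbertTensor.ofRight H K L).toLinearMap).topologicalClosure
  have hS : IsClosed (S : Set (HilbertTensor H (HilbertTensor K L))) :=
    Submodule.isClosed_topologicalClosure _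
  have h1 (h : H) (y : HilbertTensor K L) : HilbertTensor.of H _ (h ⊗ₜ y) ∈ S := by
    refine HilbertTensor.denseRange_of.induction_on
      (p := fun y => HilbertTensor.of H _ (h ⊗ₜ y) ∈ S) y (hS.preimage ?_) fun v => ?_
    · exact (HilbertTensor.of H _).continuous.comp
        (TensorProduct.continuous_tmul.comp (Continuous.prodMk continuous_const continuous_id))
    · refine Submodule.le_topologicalClosure _
        ⟨(TensorProduct.assoc ℂ H K L).symm (h ⊗ₜ v), ?_⟩
      change HilbertTensor.of H _ (TensorProduct.mapIsometry LinearIsometry.id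
        (HilbertTensor.of K L) (TensorProduct.assoc ℂ H K L
          ((TensorProduct.assoc ℂ H K L).symm (h ⊗ₜ v)))) = _
      rw [LinearEquiv.apply_symm_apply]
      rfl
  have h2 (x : H ⊗[ℂ] HilbertTensor K L) : HilbertTensor.of H _ x ∈ S := by
    induction x using TensorProduct.induction_on with
    | zero => rw [map_zero]; exact S.zero_mem
    | add x y hx hy => rw [map_add]; exact S.add_mem hx hy
    | tmul a b => exact h1 a b
  intro t
  exact HilbertTensor.denseRange_of.induction_on (p := fun t => t ∈ S) t hS h2

/-- The inequality converse to `norm_tensorRep_assoc`. -/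
theorem norm_tensorRep_assoc_le {H K L : Type u}
    [NormedAddCommGroup H] [InnerProductSpace ℂ H] [CompleteSpace H]
    [NormedAddCommGroup K] [InnerProductSpace ℂ K] [CompleteSpace K]
    [NormedAddCommGroup L] [InnerProductSpace ℂ L] [CompleteSpace L]
    (π : A →⋆ₐ[ℂ] (H →L[ℂ] H)) (ρ : B →⋆ₐ[ℂ] (K →L[ℂ] K)) (σ : C →⋆ₐ[ℂ] (L →L[ℂ] L))
    (x : (A ⊗[ℂ] B) ⊗[ℂ] C) :
    ‖tensorRep π (tensorRep ρ σ) (algAssoc A B C x)‖ ≤ ‖tensorRep (tensorRep π ρ) σ x‖ := by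
  refine ContinuousLinearMap.opNorm_le_bound _ (norm_nonneg _) fun u => ?_
  refine HilbertTensor.denseRange_ofRight.induction_on
    (p := fun u => ‖tensorRep π (tensorRep ρ σ) (algAssoc A B C x) u‖ ≤
      ‖tensorRep (tensorRep π ρ) σ x‖ * ‖u‖) u
    (isClosed_le (by fun_prop) (by fun_prop)) fun v => ?_
  obtain ⟨w, h1, h2⟩ := exists_tensorRep_ofLeft_ofRight π ρ σ x v
  rw [h2, LinearIsometry.norm_map, LinearIsometry.norm_map,
    ← (HilbertTensor.ofLeft H K L).norm_map w, ← h1, ← (HilbertTensor.ofLeft H K L).norm_map v]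
  exact ContinuousLinearMap.le_opNorm _ _

variable [FiniteDimensional ℂ A]

theorem exists_norm_algSliceLeft_assoc_le (f : A →ₗ[ℂ] ℂ) : ∃ k : ℝ,
    ∀ x : (A ⊗[ℂ] B) ⊗[ℂ] C,
      ‖MinTensor.of B C (algSliceLeft (B ⊗[ℂ] C) f (algAssoc A B C x))‖ ≤
        k * (minSeminorm₃ A B C).toFun x := by
  obtain ⟨k, hk, h⟩ := isSliceBounded f
  refine ⟨k, fun x => ?_⟩
  have h0 := (minSeminorm₃ A B C).nonneg' x
  rw [CStarSeminorm.norm_of]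
  refine minSeminorm_le _ (by positivity) fun r s => ?_
  refine h _ _ (tensorRep r.hom s.hom) (algAssoc A B C x) _ h0 fun q => ?_
  exact (norm_tensorRep_assoc_le q.hom r.hom s.hom x).trans
    (le_ciSup (bddAbove_tensorRep₃ A B C x) (q, r, s))

/-- The slice map `f ⊗ id ⊗ id` is well defined on the unbracketed tensor product `A ⊗ B ⊗ C`, and
the slices by a basis of functionals determine an element of `A ⊗ (B ⊗ C)`. -/
theorem MinTensor.injective_unbracketRight :
    Function.Injective (MinTensor.unbracketRight A B C) := by
  refine (injective_iff_map_eq_zero (MinTensor.unbracketRight A B C)).2 fun t ht => ?_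
  let e := Module.finBasis ℂ A
  refine MinTensor.ext_slice (e := e) fun i => ?_
  obtain ⟨k, hk⟩ := exists_norm_algSliceLeft_assoc_le (B := B) (C := C) (e.coord i)
  let S : MinTensor₃ A B C →L[ℂ] B ⊗ₘ C := (minSeminorm₃ A B C).liftL
    ((MinTensor.of B C).toAlgHom.toLinearMap ∘ₗ algSliceLeft (B ⊗[ℂ] C) (e.coord i) ∘ₗ
      (algAssoc A B C).toAlgHom.toLinearMap) k hk
  have hS (x : (A ⊗[ℂ] B) ⊗[ℂ] C) : S (MinTensor₃.of A B C x) =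
      MinTensor.of B C (algSliceLeft (B ⊗[ℂ] C) (e.coord i) (algAssoc A B C x)) :=
    CStarSeminorm.liftL_of _ _ _ hk x
  have key (t : A ⊗ₘ (B ⊗ₘ C)) :
      MinTensor.slice (B ⊗ₘ C) (e.coord i) t = S (MinTensor.unbracketRight A B C t) := by
    refine MinTensor.denseRange_ofRight.induction_on (p := fun t =>
      MinTensor.slice (B ⊗ₘ C) (e.coord i) t = S (MinTensor.unbracketRight A B C t)) t
      (isClosed_eq (by fun_prop) (S.continuous.comp (continuous_starAlgHom _))) fun x => ?_
    rw [MinTensor.unbracketRight_ofRight, hS]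
    change MinTensor.slice (B ⊗ₘ C) (e.coord i) (MinTensor.of A (B ⊗ₘ C)
      (algTensorMap (StarAlgHom.id ℂ A) (MinTensor.of B C) (algAssoc A B C x))) = _
    rw [MinTensor.slice_of]
    induction algAssoc A B C x using TensorProduct.induction_on with
    | zero => simp only [map_zero]
    | add x y hx hy => simp only [map_add, hx, hy]
    | tmul a y =>
      rw [algTensorMap_tmul, algSliceLeft_tmul_of_ring, algSliceLeft_tmul_of_ring, map_smul]
      rfl
  rw [key, ht, map_zero, map_zero]

end Unbracket

/-! ### The free `*`-algebra on a square matrix of generators -/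

section FreeStar

instance (X : Type*) : StarModule ℝ (FreeAlgebra ℝ X) where
  star_smul r x := by
    rw [Algebra.smul_def, star_mul, FreeAlgebra.star_algebraMap, ← Algebra.commutes,
      ← Algebra.smul_def, star_trivial r]

/-- The free complex `*`-algebra on a family `X` of self-adjoint generators: the complexification
of the free real algebra, whose involution reverses words and conjugates coefficients. -/
def FreeStarAlgebra (X : Type u) : Type u := ℂ ⊗[ℝ] FreeAlgebra ℝ X

namespace FreeStarAlgebra

variable {X : Type u}

instance : Ring (FreeStarAlgebra X) := inferInstanceAs (Ring (ℂ ⊗[ℝ] FreeAlgebra ℝ X))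
instance : Algebra ℂ (FreeStarAlgebra X) := inferInstanceAs (Algebra ℂ (ℂ ⊗[ℝ] FreeAlgebra ℝ X))
instance : StarRing (FreeStarAlgebra X) := inferInstanceAs (StarRing (ℂ ⊗[ℝ] FreeAlgebra ℝ X))
instance : StarModule ℂ (FreeStarAlgebra X) where
  star_smul c x := by
    change star (c • (show ℂ ⊗[ℝ] FreeAlgebra ℝ X from x)) =
      star c • star (show ℂ ⊗[ℝ] FreeAlgebra ℝ X from x)
    induction (show ℂ ⊗[ℝ] FreeAlgebra ℝ X from x) using TensorProduct.induction_on with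
    | zero => simp
    | add x y hx hy => rw [smul_add, star_add, hx, hy, star_add, smul_add]
    | tmul a b =>
      rw [TensorProduct.smul_tmul', TensorProduct.star_tmul, TensorProduct.star_tmul,
        TensorProduct.smul_tmul', star_smul]

/-- The self-adjoint generator labelled by `x`. -/
def gen (x : X) : FreeStarAlgebra X :=
  ((1 : ℂ) ⊗ₜ[ℝ] FreeAlgebra.ι ℝ x : ℂ ⊗[ℝ] FreeAlgebra ℝ X)

theorem star_gen (x : X) : star (gen x) = gen x := by
  change star ((1 : ℂ) ⊗ₜ[ℝ] FreeAlgebra.ι ℝ x) = (1 : ℂ) ⊗ₜ[ℝ] FreeAlgebra.ι ℝ x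
  rw [TensorProduct.star_tmul, star_one, FreeAlgebra.star_ι]

theorem induction {p : FreeStarAlgebra X → Prop} (hc : ∀ c, p (algebraMap ℂ _ c))
    (hg : ∀ x, p (gen x)) (hadd : ∀ a b, p a → p b → p (a + b))
    (hmul : ∀ a b, p a → p b → p (a * b)) (a : FreeStarAlgebra X) : p a := by
  induction a using TensorProduct.induction_on with
  | zero =>
    have h0 := hc 0
    rw [map_zero] at h0
    exact h0
  | add x y hx hy => exact hadd x y hx hy
  | tmul c y =>
    have h : c ⊗ₜ[ℝ] y = (c ⊗ₜ[ℝ] 1 : ℂ ⊗[ℝ] FreeAlgebra ℝ X) * (1 ⊗ₜ[ℝ] y) := by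
      rw [Algebra.TensorProduct.tmul_mul_tmul, mul_one, one_mul]
    rw [h]
    refine hmul _ _ (hc c) ?_
    induction y using FreeAlgebra.induction with
    | grade0 r =>
      have : ((1 : ℂ) ⊗ₜ[ℝ] algebraMap ℝ (FreeAlgebra ℝ X) r : ℂ ⊗[ℝ] FreeAlgebra ℝ X) =
          (r : ℂ) ⊗ₜ[ℝ] 1 := by
        rw [Algebra.algebraMap_eq_smul_one, TensorProduct.tmul_smul, TensorProduct.smul_tmul',
          Complex.real_smul, mul_one]
      rw [this]
      exact hc r
    | grade1 x => exact hg x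
    | mul a b ha hb =>
      have : ((1 : ℂ) ⊗ₜ[ℝ] (a * b) : ℂ ⊗[ℝ] FreeAlgebra ℝ X) = (1 ⊗ₜ[ℝ] a) * (1 ⊗ₜ[ℝ] b) := by
        rw [Algebra.TensorProduct.tmul_mul_tmul, one_mul]
      rw [this]
      exact hmul _ _ (ha (by simp)) (hb (by simp))
    | add a b ha hb =>
      rw [TensorProduct.tmul_add]
      exact hadd _ _ (ha (by simp)) (hb (by simp))

variable {B : Type*} [CStarAlgebra B]

/-- The underlying algebra homomorphism of `lift`. -/
def liftAlg (f : X → B) : FreeStarAlgebra X →ₐ[ℂ] B :=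
  Algebra.TensorProduct.lift (Algebra.ofId ℂ B) (FreeAlgebra.lift ℝ f)
    fun c _ => Algebra.commutes c _

theorem liftAlg_gen (f : X → B) (x : X) : liftAlg f (gen x) = f x := by
  refine (Algebra.TensorProduct.lift_tmul _ _ _ (1 : ℂ) (FreeAlgebra.ι ℝ x)).trans ?_
  rw [map_one, one_mul, FreeAlgebra.lift_ι_apply]

/-- The `*`-homomorphism that sends the generators to given self-adjoint elements. -/
def lift (f : X → B) (hf : ∀ x, IsSelfAdjoint (f x)) : FreeStarAlgebra X →⋆ₐ[ℂ] B where
  __ := liftAlg f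
  map_star' a := by
    change liftAlg f (star a) = star (liftAlg f a)
    induction a using induction with
    | hc c => rw [← algebraMap_star_comm, AlgHom.commutes, AlgHom.commutes, algebraMap_star_comm]
    | hg x => rw [star_gen, liftAlg_gen, (hf x).star_eq]
    | hadd a b ha hb => rw [star_add, map_add, map_add, star_add, ha, hb]
    | hmul a b ha hb => rw [star_mul, map_mul, map_mul, star_mul, ha, hb]

theorem lift_gen (f : X → B) (hf : ∀ x, IsSelfAdjoint (f x)) (x : X) :
    lift f hf (gen x) = f x := liftAlg_gen f x

theorem hom_ext {φ ψ : FreeStarAlgebra X →⋆ₐ[ℂ] B} (h : ∀ x, φ (gen x) = ψ (gen x)) : φ = ψ := by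
  ext a
  induction a using induction with
  | hc c => rw [AlgHomClass.commutes, AlgHomClass.commutes]
  | hg x => exact h x
  | hadd a b ha hb => rw [map_add, map_add, ha, hb]
  | hmul a b ha hb => rw [map_mul, map_mul, ha, hb]

/-- A family of `*`-homomorphisms that is bounded on the generators is pointwise bounded. -/
theorem bddAbove_norm {κ : Type*} {B : κ → Type*} [∀ i, CStarAlgebra (B i)]
    (R : ∀ i, FreeStarAlgebra X →⋆ₐ[ℂ] B i)
    (h : ∀ x, BddAbove (Set.range fun i => ‖R i (gen x)‖)) (a : FreeStarAlgebra X) :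
    BddAbove (Set.range fun i => ‖R i a‖) := by
  induction a using induction with
  | hc c =>
    refine ⟨‖c‖, ?_⟩
    rintro _ ⟨i, rfl⟩
    simp only [AlgHomClass.commutes]
    exact NonUnitalStarAlgHom.norm_apply_le (StarAlgHom.ofId ℂ (B i)) c
  | hg x => exact h x
  | hadd a b ha hb =>
    obtain ⟨k, hk⟩ := ha
    obtain ⟨l, hl⟩ := hb
    refine ⟨k + l, ?_⟩
    rintro _ ⟨i, rfl⟩
    simp only [map_add]
    exact (norm_add_le _ _).trans (add_le_add (hk ⟨i, rfl⟩) (hl ⟨i, rfl⟩))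
  | hmul a b ha hb =>
    obtain ⟨k, hk⟩ := ha
    obtain ⟨l, hl⟩ := hb
    refine ⟨k * l, ?_⟩
    rintro _ ⟨i, rfl⟩
    simp only [map_mul]
    exact (norm_mul_le _ _).trans (mul_le_mul (hk ⟨i, rfl⟩) (hl ⟨i, rfl⟩) (norm_nonneg _)
      ((norm_nonneg _).trans (hk ⟨i, rfl⟩)))

end FreeStarAlgebra

/-- The free `*`-algebra on the entries of an `ι × ι` matrix. Its self-adjoint generators are the
real parts (left summand) and the imaginary parts (right summand) of the entries. -/
abbrev FreeMatrixAlgebra (ι : Type u) : Type u := FreeStarAlgebra (ι × ι ⊕ ι × ι)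

namespace FreeMatrixAlgebra

open Complex

variable {ι : Type u} {B : Type*} [CStarAlgebra B]

/-- The entry with index `(i, j)` of the generating matrix. -/
def entry (i j : ι) : FreeMatrixAlgebra ι :=
  FreeStarAlgebra.gen (.inl (i, j)) + I • FreeStarAlgebra.gen (.inr (i, j))

/-- The `*`-homomorphism that sends the generating matrix to the matrix `d`. -/
def lift (d : ι → ι → B) : FreeMatrixAlgebra ι →⋆ₐ[ℂ] B :=
  FreeStarAlgebra.lift
    (Sum.elim (fun x => (realPart (d x.1 x.2) : B)) fun x => (imaginaryPart (d x.1 x.2) : B))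
    (by rintro (x | x) <;> exact selfAdjoint.mem_iff.1 (Subtype.property _))

theorem lift_entry (d : ι → ι → B) (i j : ι) : lift d (entry i j) = d i j := by
  rw [entry, map_add, map_smul, lift, FreeStarAlgebra.lift_gen, FreeStarAlgebra.lift_gen]
  exact realPart_add_I_smul_imaginaryPart (d i j)

theorem hom_ext {φ ψ : FreeMatrixAlgebra ι →⋆ₐ[ℂ] B}
    (h : ∀ i j, φ (entry i j) = ψ (entry i j)) : φ = ψ := by
  -- The self-adjoint generators are the real and imaginary parts of the entries.
  have key (i j : ι) : FreeStarAlgebra.gen (.inl (i, j)) =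
        (2⁻¹ : ℂ) • (entry i j + star (entry i j)) ∧
      FreeStarAlgebra.gen (.inr (i, j)) = (-(I / 2)) • (entry i j - star (entry i j)) := by
    simp only [entry, star_add, star_smul, FreeStarAlgebra.star_gen, Complex.star_def, conj_I]
    constructor
    · module
    · match_scalars <;> ring_nf
      simp
  refine FreeStarAlgebra.hom_ext ?_
  rintro (⟨i, j⟩ | ⟨i, j⟩)
  · rw [(key i j).1]
    simp only [map_smul, map_add, map_star, h]
  · rw [(key i j).2]
    simp only [map_smul, map_sub, map_star, h]

theorem bddAbove_norm {κ : Type*} {B : κ → Type*} [∀ i, CStarAlgebra (B i)]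
    (d : ∀ k, ι → ι → B k) (h : ∀ i j, BddAbove (Set.range fun k => ‖d k i j‖))
    (a : FreeMatrixAlgebra ι) : BddAbove (Set.range fun k => ‖lift (d k) a‖) := by
  refine FreeStarAlgebra.bddAbove_norm _ ?_ a
  rintro (⟨i, j⟩ | ⟨i, j⟩)
  · obtain ⟨c, hc⟩ := h i j
    refine ⟨c, ?_⟩
    rintro _ ⟨k, rfl⟩
    simp only [lift, FreeStarAlgebra.lift_gen, Sum.elim_inl]
    exact (realPart.norm_le (d k i j)).trans (hc ⟨k, rfl⟩)
  · obtain ⟨c, hc⟩ := h i j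
    refine ⟨c, ?_⟩
    rintro _ ⟨k, rfl⟩
    simp only [lift, FreeStarAlgebra.lift_gen, Sum.elim_inr]
    exact (imaginaryPart.norm_le (d k i j)).trans (hc ⟨k, rfl⟩)

end FreeMatrixAlgebra

end FreeStar

/-! ### Matrix coefficients of quantum families -/

section Coefficients

variable {M D D' E W : Type u} [CStarAlgebra M] [FiniteDimensional ℂ M] [CStarAlgebra D]
  [CStarAlgebra D'] [CStarAlgebra E] [CStarAlgebra W]
  {ι : Type u} [Fintype ι] (e : Module.Basis ι ℂ M)

theorem starAlgHom_ext_basis {M B : Type*} [CStarAlgebra M] [CStarAlgebra B] {ι : Type*}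
    (e : Module.Basis ι ℂ M) {f g : M →⋆ₐ[ℂ] B}
    (h : ∀ j, f (e j) = g (e j)) : f = g := by
  have : f.toAlgHom.toLinearMap = g.toAlgHom.toLinearMap := e.ext h
  ext a
  exact LinearMap.congr_fun this a

/-- The matrix coefficients `u i j` of a quantum family, given by `Ψ (e j) = ∑ i, e i ⊗ u i j`. -/
def coef (Ψ : QuantumFamily M M D) (i j : ι) : D := MinTensor.slice D (e.coord i) (Ψ (e j))

variable {e}

theorem sum_coef (Ψ : QuantumFamily M M D) (j : ι) :
    Ψ (e j) = ∑ i, MinTensor.of M D (e i ⊗ₜ coef e Ψ i j) :=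
  (MinTensor.sum_of_slice e (Ψ (e j))).symm

theorem coef_ext {Ψ Ψ' : QuantumFamily M M D} (h : ∀ i j, coef e Ψ i j = coef e Ψ' i j) :
    Ψ = Ψ' :=
  starAlgHom_ext_basis e fun j => MinTensor.ext_slice (e := e) fun i => h i j

theorem coef_eq_of_apply {Ψ : QuantumFamily M M D} {j : ι} {d : ι → D}
    (h : Ψ (e j) = ∑ i, MinTensor.of M D (e i ⊗ₜ d i)) (i : ι) : coef e Ψ i j = d i := by
  classical
  rw [coef, h, MinTensor.slice_sum_of]

theorem MinTensor.map_of_tmul {A B C D : Type u} [CStarAlgebra A] [CStarAlgebra B]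
    [CStarAlgebra C] [CStarAlgebra D] (f : A →⋆ₐ[ℂ] C) (g : B →⋆ₐ[ℂ] D) (a : A) (b : B) :
    MinTensor.map f g (MinTensor.of A B (a ⊗ₜ b)) = MinTensor.of C D (f a ⊗ₜ g b) := by
  rw [MinTensor.map_of, algTensorMap_tmul]

theorem coef_changeParameter (Φ : QuantumFamily M M E) (Λ : E →⋆ₐ[ℂ] D) (i j : ι) :
    coef e (changeParameter Φ Λ) i j = Λ (coef e Φ i j) := by
  refine coef_eq_of_apply (d := fun i => Λ (coef e Φ i j)) ?_ i
  change MinTensor.map (StarAlgHom.id ℂ M) Λ (Φ (e j)) = _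
  rw [sum_coef, map_sum]
  simp only [MinTensor.map_of_tmul]
  rfl

theorem changeParameter_eq_iff {Φ : QuantumFamily M M E} {Λ : E →⋆ₐ[ℂ] D}
    {Ψ : QuantumFamily M M D} :
    changeParameter Φ Λ = Ψ ↔ ∀ i j, Λ (coef e Φ i j) = coef e Ψ i j :=
  ⟨fun h i j => by rw [← h, coef_changeParameter],
    fun h => coef_ext (e := e) fun i j => by rw [coef_changeParameter, h]⟩

theorem preservesState_iff {Ψ : QuantumFamily M M D} {ω : M →L[ℂ] ℂ} {hω : IsState ω} :
    PreservesState Ψ ω hω ↔ ∀ j, ∑ i, ω (e i) • coef e Ψ i j = ω (e j) • (1 : D) := by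
  have key (j : ι) : MinTensor.sliceLeft D ω.toLinearMap hω.isPositiveFunctional (Ψ (e j)) =
      ∑ i, ω (e i) • coef e Ψ i j := by
    rw [sum_coef, map_sum]
    exact Finset.sum_congr rfl fun i _ => MinTensor.sliceLeft_tmul _ _ _ _
  refine ⟨fun h j => by rw [← key, h], fun h => ?_⟩
  let f : M →ₗ[ℂ] D := (MinTensor.sliceLeft D ω.toLinearMap hω.isPositiveFunctional).toLinearMap ∘ₗ
    Ψ.toAlgHom.toLinearMap
  have : f = ω.toLinearMap.smulRight (1 : D) := e.ext fun j => (key j).trans (h j)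
  exact fun x => LinearMap.congr_fun this x

theorem PreservesState.changeParameter {Φ : QuantumFamily M M E} {ω : M →L[ℂ] ℂ} {hω : IsState ω}
    (h : PreservesState Φ ω hω) (Λ : E →⋆ₐ[ℂ] D) : PreservesState (changeParameter Φ Λ) ω hω := by
  let e := Module.finBasis ℂ M |>.reindex Equiv.ulift.{u}.symm
  rw [preservesState_iff (e := e)] at h ⊢
  intro j
  have := congrArg Λ (h j)
  rw [map_sum, map_smul, map_one] at this
  simpa only [coef_changeParameter, map_smul] using this

theorem ClassifiesPreserving.hom_ext {Φ : QuantumFamily M M W} {ω : M →L[ℂ] ℂ} {hω : IsState ω}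
    (h : ClassifiesPreserving Φ ω hω) (hΦ : PreservesState Φ ω hω) {f g : W →⋆ₐ[ℂ] D}
    (hfg : ∀ i j, f (coef e Φ i j) = g (coef e Φ i j)) : f = g :=
  (h D _ (hΦ.changeParameter g)).unique (changeParameter_eq_iff.2 fun i j => by
    rw [hfg, coef_changeParameter]) rfl

theorem IsFamilyOfAllMaps.hom_ext {Φ : QuantumFamily M M E} (h : IsFamilyOfAllMaps Φ)
    {f g : E →⋆ₐ[ℂ] D} (hfg : ∀ i j, f (coef e Φ i j) = g (coef e Φ i j)) : f = g :=
  (h D (changeParameter Φ g)).unique (changeParameter_eq_iff.2 fun i j => by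
    rw [hfg, coef_changeParameter]) rfl

/-! ### Composition of families in terms of coefficients -/

/-- The family `Φ` with values in the algebraic tensor product, which exhausts `M ⊗ E` because `M`
is finite-dimensional. -/
def algFamily (Φ : QuantumFamily M M E) : M →⋆ₐ[ℂ] M ⊗[ℂ] E :=
  ((StarAlgEquiv.ofBijective (MinTensor.of M E) MinTensor.bijective_of).symm :
    M ⊗ₘ E →⋆ₐ[ℂ] M ⊗[ℂ] E).comp Φ

theorem of_algFamily (Φ : QuantumFamily M M E) (m : M) :
    MinTensor.of M E (algFamily Φ m) = Φ m :=
  (StarAlgEquiv.ofBijective (MinTensor.of M E) MinTensor.bijective_of).apply_symm_apply (Φ m)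

theorem algFamily_basis (Φ : QuantumFamily M M E) (j : ι) :
    algFamily Φ (e j) = ∑ i, e i ⊗ₜ coef e Φ i j :=
  MinTensor.bijective_of.1 (by rw [of_algFamily, sum_coef, map_sum])

/-- The composition `Φ △ Φ` as a quantum family with values in `M ⊗ (E ⊗ E)`. -/
def selfComposition (Φ : QuantumFamily M M E) : QuantumFamily M M (E ⊗ₘ E) :=
  (MinTensor.ofRight M E E).comp
    ((algTensorMap (algFamily Φ) (StarAlgHom.id ℂ E)).comp (algFamily Φ))

theorem unbracketRight_selfComposition (Φ : QuantumFamily M M E) :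
    (MinTensor.unbracketRight M E E).comp (selfComposition Φ) = composeFamilies Φ Φ := by
  ext m
  change MinTensor.unbracketRight M E E (MinTensor.ofRight M E E
      (algTensorMap (algFamily Φ) (StarAlgHom.id ℂ E) (algFamily Φ m))) =
    MinTensor.unbracketLeft M E E (MinTensor.map Φ (StarAlgHom.id ℂ E) (Φ m))
  rw [MinTensor.unbracketRight_ofRight, ← MinTensor.unbracketLeft_ofLeft]
  congr 1
  rw [← of_algFamily Φ m, MinTensor.map_of]
  change MinTensor.of (M ⊗ₘ E) E (algTensorMap (MinTensor.of M E) (StarAlgHom.id ℂ E)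
    (algTensorMap (algFamily Φ) (StarAlgHom.id ℂ E) (algFamily Φ m))) = _
  congr 1
  induction algFamily Φ m using TensorProduct.induction_on with
  | zero => simp only [map_zero]
  | add x y hx hy => simp only [map_add, hx, hy]
  | tmul a b =>
    simp only [algTensorMap_tmul, of_algFamily]
    rfl

theorem coef_selfComposition (Φ : QuantumFamily M M E) (i j : ι) :
    coef e (selfComposition Φ) i j =
      ∑ k, MinTensor.of E E (coef e Φ i k ⊗ₜ coef e Φ k j) := by
  refine coef_eq_of_apply
    (d := fun i => ∑ k, MinTensor.of E E (coef e Φ i k ⊗ₜ coef e Φ k j)) ?_ i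
  change MinTensor.of M (E ⊗ₘ E) (algTensorMap (StarAlgHom.id ℂ M) (MinTensor.of E E)
    (algAssoc M E E (algTensorMap (algFamily Φ) (StarAlgHom.id ℂ E) (algFamily Φ (e j))))) = _
  rw [algFamily_basis]
  simp only [map_sum, algTensorMap_tmul, algFamily_basis, TensorProduct.sum_tmul,
    TensorProduct.tmul_sum]
  rw [Finset.sum_comm]
  rfl

theorem encodesComposition_iff {Φ : QuantumFamily M M E} {Δ : E →⋆ₐ[ℂ] E ⊗ₘ E} :
    EncodesComposition Φ Δ ↔ changeParameter Φ Δ = selfComposition Φ := by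
  rw [EncodesComposition, ← unbracketRight_selfComposition]
  refine ⟨fun h => ?_, fun h => by rw [h]⟩
  ext m
  exact MinTensor.injective_unbracketRight (DFunLike.congr_fun h m).symm

theorem encodesComposition_iff_coef {Φ : QuantumFamily M M E} {Δ : E →⋆ₐ[ℂ] E ⊗ₘ E} :
    EncodesComposition Φ Δ ↔
      ∀ i j, Δ (coef e Φ i j) = ∑ k, MinTensor.of E E (coef e Φ i k ⊗ₜ coef e Φ k j) := by
  rw [encodesComposition_iff, changeParameter_eq_iff (e := e)]
  simp only [coef_selfComposition]

theorem PreservesState.selfComposition {Φ : QuantumFamily M M E} {ω : M →L[ℂ] ℂ}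
    {hω : IsState ω} (h : PreservesState Φ ω hω) : PreservesState (selfComposition Φ) ω hω := by
  let e := Module.finBasis ℂ M |>.reindex Equiv.ulift.{u}.symm
  rw [preservesState_iff (e := e)] at h ⊢
  intro j
  simp only [coef_selfComposition, Finset.smul_sum, ← map_smul, TensorProduct.smul_tmul']
  rw [Finset.sum_comm]
  simp only [← map_sum, ← TensorProduct.sum_tmul, h]
  simp only [← TensorProduct.smul_tmul', ← TensorProduct.tmul_smul]
  rw [← TensorProduct.tmul_sum, h, TensorProduct.tmul_smul, map_smul]
  exact congrArg _ (map_one (MinTensor.of E E))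

end Coefficients

/-! ### The universal quantum family preserving a state -/

section Universal

variable {M : Type u} [CStarAlgebra M] (ω : M →L[ℂ] ℂ) (hω : IsState ω)
  {ι : Type u}

/-- The linear map `e j ↦ ∑ i, e i ⊗ u i j` with the generating matrix `u` of the free
`*`-algebra as coefficients. -/
def genericMap [Fintype ι] (e : Module.Basis ι ℂ M) : M →ₗ[ℂ] M ⊗[ℂ] FreeMatrixAlgebra ι :=
  e.constr ℂ fun j => ∑ i, e i ⊗ₜ FreeMatrixAlgebra.entry i j

theorem genericMap_basis [Fintype ι] (e : Module.Basis ι ℂ M) (j : ι) :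
    genericMap e (e j) = ∑ i, e i ⊗ₜ FreeMatrixAlgebra.entry i j :=
  e.constr_basis ℂ _ j

variable (M) in
/-- The `*`-homomorphism `id ⊗ R : M ⊗ P → M ⊗ D`, defined on the algebraic tensor product with
the free `*`-algebra `P`. -/
def evalTensor {D : Type u} [CStarAlgebra D] (R : FreeMatrixAlgebra ι →⋆ₐ[ℂ] D) :
    M ⊗[ℂ] FreeMatrixAlgebra ι →⋆ₐ[ℂ] M ⊗ₘ D :=
  (MinTensor.of M D).comp (algTensorMap (StarAlgHom.id ℂ M) R)

theorem evalTensor_genericMap_basis [Fintype ι] (e : Module.Basis ι ℂ M)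
    {D : Type u} [CStarAlgebra D] (R : FreeMatrixAlgebra ι →⋆ₐ[ℂ] D) (j : ι) :
    evalTensor M R (genericMap e (e j)) =
      ∑ i, MinTensor.of M D (e i ⊗ₜ R (FreeMatrixAlgebra.entry i j)) := by
  rw [genericMap_basis, map_sum]
  rfl

variable [FiniteDimensional ℂ M]

theorem slice_evalTensor {D : Type u} [CStarAlgebra D] (R : FreeMatrixAlgebra ι →⋆ₐ[ℂ] D)
    (f : M →ₗ[ℂ] ℂ) (t : M ⊗[ℂ] FreeMatrixAlgebra ι) :
    MinTensor.slice D f (evalTensor M R t) = R (algSliceLeft (FreeMatrixAlgebra ι) f t) := by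
  change MinTensor.slice D f (MinTensor.of M D (algTensorMap (StarAlgHom.id ℂ M) R t)) = _
  rw [MinTensor.slice_of]
  induction t using TensorProduct.induction_on with
  | zero => simp only [map_zero]
  | add x y hx hy => simp only [map_add, hx, hy]
  | tmul a b =>
    rw [algTensorMap_tmul, algSliceLeft_tmul_of_ring, algSliceLeft_tmul_of_ring, map_smul]
    rfl

variable (e : Module.Basis ι ℂ M)

/-- A quantum family of maps `𝕄 → 𝕄` that preserves `ω`, bundled with its parameter space. -/
structure PreservingFamily where
  Param : Type u
  [cstarAlgebra : CStarAlgebra Param]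
  family : QuantumFamily M M Param
  preserves : PreservesState family ω hω

attribute [instance] PreservingFamily.cstarAlgebra

variable {ω hω}

/-- The representation of the free `*`-algebra by the matrix coefficients of a family. -/
def PreservingFamily.hom (F : PreservingFamily ω hω) : FreeMatrixAlgebra ι →⋆ₐ[ℂ] F.Param :=
  FreeMatrixAlgebra.lift (coef e F.family)

/-- The matrix coefficients are bounded uniformly over all families: `*`-homomorphisms are
contractive, and the bound on a slice map does not depend on the parameter space. -/
theorem PreservingFamily.bddAbove_hom (a : FreeMatrixAlgebra ι) :
    BddAbove (Set.range fun F : PreservingFamily ω hω => ‖F.hom e a‖) := by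
  refine FreeMatrixAlgebra.bddAbove_norm (fun F : PreservingFamily ω hω => coef e F.family)
    (fun i j => ⟨sliceBound (e.coord i) * ‖e j‖, ?_⟩) a
  rintro _ ⟨F, rfl⟩
  exact (MinTensor.norm_slice_le _ _).trans (mul_le_mul_of_nonneg_left
    (NonUnitalStarAlgHom.norm_apply_le F.family (e j)) (sliceBound_nonneg _))

variable (ω hω)

/-- The supremum of the norms which all `ω`-preserving families induce on the free `*`-algebra. -/
def universalSeminorm : CStarSeminorm (FreeMatrixAlgebra ι) :=
  CStarSeminorm.ofFamily (fun F : PreservingFamily ω hω => F.hom e)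
    (PreservingFamily.bddAbove_hom e)

/-- The algebra `C(𝕎)`: the universal `C*`-algebra generated by the matrix coefficients of an
`ω`-preserving family. -/
abbrev UniversalAlgebra : Type u := (universalSeminorm ω hω e).Completed

/-- The canonical map from the free `*`-algebra to the universal algebra. -/
abbrev UniversalAlgebra.of : FreeMatrixAlgebra ι →⋆ₐ[ℂ] UniversalAlgebra ω hω e :=
  (universalSeminorm ω hω e).of

variable {ω hω}

theorem PreservingFamily.norm_hom_le (F : PreservingFamily ω hω) (a : FreeMatrixAlgebra ι) :
    ‖F.hom e a‖ ≤ (universalSeminorm ω hω e).toFun a :=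
  le_ciSup (PreservingFamily.bddAbove_hom e a) F

variable {e}

/-- A relation between matrix coefficients that holds in all families holds in the universal
algebra. -/
theorem UniversalAlgebra.of_eq_of_forall {a b : FreeMatrixAlgebra ι}
    (h : ∀ F : PreservingFamily ω hω, F.hom e a = F.hom e b) :
    UniversalAlgebra.of ω hω e a = UniversalAlgebra.of ω hω e b := by
  rw [← sub_eq_zero, ← map_sub, ← norm_eq_zero, CStarSeminorm.norm_of]
  refine le_antisymm (Real.iSup_le (fun F => ?_) le_rfl) (CStarSeminorm.nonneg' _ _)
  rw [map_sub, h, sub_self, norm_zero]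

variable [Fintype ι]

theorem evalTensor_of_eq_of_forall {s t : M ⊗[ℂ] FreeMatrixAlgebra ι}
    (h : ∀ F : PreservingFamily ω hω, evalTensor M (F.hom e) s = evalTensor M (F.hom e) t) :
    evalTensor M (UniversalAlgebra.of ω hω e) s = evalTensor M (UniversalAlgebra.of ω hω e) t := by
  refine MinTensor.ext_slice (e := e) fun i => ?_
  rw [slice_evalTensor, slice_evalTensor]
  refine UniversalAlgebra.of_eq_of_forall fun F => ?_
  rw [← slice_evalTensor, ← slice_evalTensor, h]

theorem evalTensor_genericMap (F : PreservingFamily ω hω) (m : M) :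
    evalTensor M (F.hom e) (genericMap e m) = F.family m := by
  have : (evalTensor M (F.hom e)).toAlgHom.toLinearMap ∘ₗ genericMap e =
      F.family.toAlgHom.toLinearMap := e.ext fun j => by
    refine (evalTensor_genericMap_basis e (F.hom e) j).trans
      (Eq.trans ?_ (sum_coef F.family j).symm)
    simp only [PreservingFamily.hom, FreeMatrixAlgebra.lift_entry]
  exact LinearMap.congr_fun this m

variable (ω hω e) in
/-- The universal `ω`-preserving family. It is a `*`-homomorphism because every `ω`-preserving
family is one. -/
def universalFamily : QuantumFamily M M (UniversalAlgebra ω hω e) where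
  toFun m := evalTensor M (UniversalAlgebra.of ω hω e) (genericMap e m)
  map_one' := by
    rw [← map_one (evalTensor M (UniversalAlgebra.of ω hω e))]
    exact evalTensor_of_eq_of_forall fun F => by rw [evalTensor_genericMap, map_one, map_one]
  map_mul' a b := by
    rw [← map_mul]
    exact evalTensor_of_eq_of_forall fun F => by
      rw [map_mul (evalTensor M (F.hom e)), evalTensor_genericMap, evalTensor_genericMap,
        evalTensor_genericMap, map_mul]
  map_zero' := by rw [map_zero, map_zero]
  map_add' a b := by rw [map_add, map_add]
  commutes' c := by
    rw [← AlgHomClass.commutes (evalTensor M (UniversalAlgebra.of ω hω e))]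
    exact evalTensor_of_eq_of_forall fun F => by
      rw [evalTensor_genericMap, AlgHomClass.commutes, AlgHomClass.commutes]
  map_star' a := by
    rw [← map_star]
    exact evalTensor_of_eq_of_forall fun F => by
      rw [map_star (evalTensor M (F.hom e)), evalTensor_genericMap, evalTensor_genericMap,
        map_star]

theorem coef_universalFamily (i j : ι) : coef e (universalFamily ω hω e) i j =
    UniversalAlgebra.of ω hω e (FreeMatrixAlgebra.entry i j) :=
  coef_eq_of_apply (d := fun i => UniversalAlgebra.of ω hω e (FreeMatrixAlgebra.entry i j))
    (evalTensor_genericMap_basis e _ j) i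

theorem preservesState_universalFamily : PreservesState (universalFamily ω hω e) ω hω := by
  rw [preservesState_iff (e := e)]
  intro j
  simp only [coef_universalFamily, ← map_smul, ← map_sum]
  rw [← map_one (UniversalAlgebra.of ω hω e), ← map_smul]
  refine UniversalAlgebra.of_eq_of_forall fun F => ?_
  rw [map_sum, map_smul, map_one, ← preservesState_iff.1 F.preserves j]
  simp only [map_smul, PreservingFamily.hom, FreeMatrixAlgebra.lift_entry]

theorem classifiesPreserving_universalFamily :
    ClassifiesPreserving (universalFamily ω hω e) ω hω := by
  intro D _ Ψ hΨ
  let F : PreservingFamily ω hω := ⟨D, Ψ, hΨ⟩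
  refine ⟨(universalSeminorm ω hω e).lift (F.hom e) (F.norm_hom_le e), ?_, fun Λ hΛ => ?_⟩
  · refine (changeParameter_eq_iff (e := e)).2 fun i j => ?_
    rw [coef_universalFamily, CStarSeminorm.lift_of]
    exact FreeMatrixAlgebra.lift_entry _ i j
  · have h : Λ.comp (UniversalAlgebra.of ω hω e) = F.hom e :=
      FreeMatrixAlgebra.hom_ext fun i j => by
        rw [StarAlgHom.comp_apply, ← coef_universalFamily, changeParameter_eq_iff.1 hΛ]
        exact (FreeMatrixAlgebra.lift_entry _ i j).symm
    ext x
    refine (universalSeminorm ω hω e).denseRange_of.induction_on (p := fun x =>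
      Λ x = (universalSeminorm ω hω e).lift (F.hom e) (F.norm_hom_le e) x) x
      (isClosed_eq (continuous_starAlgHom _) (continuous_starAlgHom _)) fun a => ?_
    rw [CStarSeminorm.lift_of, ← h]
    rfl

end Universal

/-! ### Uniqueness and coassociativity -/

section Semigroup

variable {M W W' : Type u} [CStarAlgebra M] [FiniteDimensional ℂ M] [CStarAlgebra W]
  [CStarAlgebra W']
  {ω : M →L[ℂ] ℂ} {hω : IsState ω}
  {ι : Type u} [Fintype ι] {e : Module.Basis ι ℂ M}

theorem ClassifiesPreserving.existsUnique_equiv {Φ : QuantumFamily M M W}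
    {Φ' : QuantumFamily M M W'} (h : ClassifiesPreserving Φ ω hω) (hΦ : PreservesState Φ ω hω)
    (h' : ClassifiesPreserving Φ' ω hω) (hΦ' : PreservesState Φ' ω hω) :
    ∃! θ : W ≃⋆ₐ[ℂ] W', changeParameter Φ (θ : W →⋆ₐ[ℂ] W') = Φ' := by
  let e := Module.finBasis ℂ M |>.reindex Equiv.ulift.{u}.symm
  obtain ⟨f, hf, -⟩ := h W' Φ' hΦ'
  obtain ⟨g, hg, -⟩ := h' W Φ hΦ
  rw [changeParameter_eq_iff (e := e)] at hf hg
  have hgf : g.comp f = StarAlgHom.id ℂ W := h.hom_ext (e := e) hΦ fun i j => by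
    rw [StarAlgHom.comp_apply, hf, hg]
    rfl
  have hfg : f.comp g = StarAlgHom.id ℂ W' := h'.hom_ext (e := e) hΦ' fun i j => by
    rw [StarAlgHom.comp_apply, hg, hf]
    rfl
  refine ⟨StarAlgEquiv.ofStarAlgHom f g hgf hfg, (changeParameter_eq_iff (e := e)).2 hf,
    fun θ hθ => ?_⟩
  have : (θ : W →⋆ₐ[ℂ] W') = f := h.hom_ext (e := e) hΦ fun i j => by
    rw [changeParameter_eq_iff.1 hθ, hf]
  ext x
  exact DFunLike.congr_fun this x

/-- Both iterated comultiplications send `u i j` to `∑ k, ∑ l, u i k ⊗ u k l ⊗ u l j`. -/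
theorem isCoassociative_of_coef {Φ : QuantumFamily M M W} (h : ClassifiesPreserving Φ ω hω)
    (hΦ : PreservesState Φ ω hω) {Δ : W →⋆ₐ[ℂ] W ⊗ₘ W}
    (hΔ : ∀ i j, Δ (coef e Φ i j) = ∑ k, MinTensor.of W W (coef e Φ i k ⊗ₜ coef e Φ k j)) :
    IsCoassociative Δ := by
  have hL (a b c : W) : MinTensor.unbracketLeft W W W
      (MinTensor.of (W ⊗ₘ W) W (MinTensor.of W W (a ⊗ₜ b) ⊗ₜ c)) =
        MinTensor₃.of W W W ((a ⊗ₜ b) ⊗ₜ c) := MinTensor.unbracketLeft_ofLeft ((a ⊗ₜ b) ⊗ₜ c)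
  have hR (a b c : W) : MinTensor.unbracketRight W W W
      (MinTensor.of W (W ⊗ₘ W) (a ⊗ₜ MinTensor.of W W (b ⊗ₜ c))) =
        MinTensor₃.of W W W ((a ⊗ₜ b) ⊗ₜ c) := MinTensor.unbracketRight_ofRight ((a ⊗ₜ b) ⊗ₜ c)
  refine h.hom_ext (e := e) hΦ fun i j => ?_
  simp only [StarAlgHom.comp_apply, hΔ, map_sum, MinTensor.map_of_tmul, TensorProduct.sum_tmul,
    TensorProduct.tmul_sum, StarAlgHom.coe_id, id_eq, hL, hR]
  exact Finset.sum_comm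

end Semigroup

/-! ### The counit -/

section Counit

variable {A B : Type u} [CStarAlgebra A] [CStarAlgebra B]

/-- The slice map `ε ⊗ id` of a character `ε` is a `*`-homomorphism. -/
def MinTensor.characterLeft (B : Type u) [CStarAlgebra B] (ε : A →⋆ₐ[ℂ] ℂ) : A ⊗ₘ B →⋆ₐ[ℂ] B :=
  (minSeminorm A B).lift
    { (Algebra.TensorProduct.lid ℂ B).toAlgHom.comp
        (Algebra.TensorProduct.map ε.toAlgHom (AlgHom.id ℂ B)) with
      map_star' := fun x => by
        change algSliceLeft B ε.toAlgHom.toLinearMap (star x) =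
          star (algSliceLeft B ε.toAlgHom.toLinearMap x)
        induction x using TensorProduct.induction_on with
        | zero => simp
        | add x y hx hy => rw [star_add, map_add, map_add, star_add, hx, hy]
        | tmul a b =>
          rw [TensorProduct.star_tmul, algSliceLeft_tmul, algSliceLeft_tmul, star_smul]
          exact congrArg (· • star b) (map_star ε a) }
    fun x => by
      have h := norm_algSliceLeft_le (B := B) _ (isPositiveFunctional_character ε) x
      have h1 : (ε.toAlgHom.toLinearMap 1).re = 1 := by
        change (ε 1).re = 1
        rw [map_one, Complex.one_re]
      rw [h1, one_mul] at h
      exact h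

/-- The slice map `id ⊗ ε` of a character `ε` is a `*`-homomorphism. -/
def MinTensor.characterRight (A : Type u) [CStarAlgebra A] (ε : B →⋆ₐ[ℂ] ℂ) : A ⊗ₘ B →⋆ₐ[ℂ] A :=
  (minSeminorm A B).lift
    { (Algebra.TensorProduct.rid ℂ ℂ A).toAlgHom.comp
        (Algebra.TensorProduct.map (AlgHom.id ℂ A) ε.toAlgHom) with
      map_star' := fun x => by
        change algSliceRight A ε.toAlgHom.toLinearMap (star x) =
          star (algSliceRight A ε.toAlgHom.toLinearMap x)
        induction x using TensorProduct.induction_on with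
        | zero => simp
        | add x y hx hy => rw [star_add, map_add, map_add, star_add, hx, hy]
        | tmul a b =>
          rw [TensorProduct.star_tmul, algSliceRight_tmul, algSliceRight_tmul, star_smul]
          exact congrArg (· • star a) (map_star ε b) }
    fun x => by
      have h := norm_algSliceRight_le (A := A) _ (isPositiveFunctional_character ε) x
      have h1 : (ε.toAlgHom.toLinearMap 1).re = 1 := by
        change (ε 1).re = 1
        rw [map_one, Complex.one_re]
      rw [h1, one_mul] at h
      exact h

theorem MinTensor.characterLeft_apply (ε : A →⋆ₐ[ℂ] ℂ) (t : A ⊗ₘ B) :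
    MinTensor.characterLeft B ε t =
      MinTensor.sliceLeft B _ (isPositiveFunctional_character ε) t := rfl

theorem MinTensor.characterRight_apply (ε : B →⋆ₐ[ℂ] ℂ) (t : A ⊗ₘ B) :
    MinTensor.characterRight A ε t =
      MinTensor.sliceRight A _ (isPositiveFunctional_character ε) t := rfl

variable {M W : Type u} [CStarAlgebra M] [CStarAlgebra W] {ω : M →L[ℂ] ℂ} {hω : IsState ω}

variable (M) in
/-- The family that consists of the identity map of `𝕄` only. Its one-point parameter space is
given by the copy `PUnit → ℂ` of `ℂ` in `Type u`. -/
def identityFamily : QuantumFamily M M (PUnit.{u + 1} → ℂ) :=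
  (MinTensor.of M (PUnit.{u + 1} → ℂ)).comp
    { Algebra.TensorProduct.includeLeft with
      map_star' := fun a => by
        change star a ⊗ₜ[ℂ] 1 = star (a ⊗ₜ[ℂ] 1)
        rw [TensorProduct.star_tmul, star_one] }

theorem identityFamily_apply (m : M) :
    identityFamily M m = MinTensor.of M (PUnit.{u + 1} → ℂ) (m ⊗ₜ 1) := rfl

theorem preservesState_identityFamily : PreservesState (identityFamily M) ω hω :=
  fun _ => MinTensor.sliceLeft_tmul _ _ _ _

variable [FiniteDimensional ℂ M] {ι : Type u} {e : Module.Basis ι ℂ M}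

theorem coef_identityFamily [DecidableEq ι] (i j : ι) :
    coef e (identityFamily M) i j = if i = j then 1 else 0 := by
  rw [coef, identityFamily_apply, MinTensor.slice_of_tmul, Module.Basis.coord_apply,
    Module.Basis.repr_self, Finsupp.single_apply]
  simp [eq_comm]

variable [Fintype ι]

/-- The counit is the parameter `W → ℂ` of the family that consists of the identity map. -/
theorem exists_isCounit_of_coef {Φ : QuantumFamily M M W} (h : ClassifiesPreserving Φ ω hω)
    (hΦ : PreservesState Φ ω hω) {Δ : W →⋆ₐ[ℂ] W ⊗ₘ W}
    (hΔ : ∀ i j, Δ (coef e Φ i j) = ∑ k, MinTensor.of W W (coef e Φ i k ⊗ₜ coef e Φ k j)) :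
    ∃ ε : W →⋆ₐ[ℂ] ℂ, IsCounit Δ ε := by
  classical
  obtain ⟨f, hf, -⟩ := h _ (identityFamily M) preservesState_identityFamily
  let ε : W →⋆ₐ[ℂ] ℂ := (Pi.evalStarAlgHom ℂ (fun _ : PUnit.{u + 1} => ℂ) PUnit.unit).comp f
  have hε (i j : ι) : ε (coef e Φ i j) = if i = j then 1 else 0 := by
    change f (coef e Φ i j) PUnit.unit = _
    rw [changeParameter_eq_iff.1 hf, coef_identityFamily]
    split_ifs <;> rfl
  have hl : (MinTensor.characterLeft W ε).comp Δ = StarAlgHom.id ℂ W :=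
    h.hom_ext (e := e) hΦ fun i j => by
      rw [StarAlgHom.comp_apply, hΔ, map_sum]
      simp only [MinTensor.characterLeft_apply, MinTensor.sliceLeft_tmul]
      change ∑ k, ε (coef e Φ i k) • coef e Φ k j = coef e Φ i j
      simp [hε]
  have hr : (MinTensor.characterRight W ε).comp Δ = StarAlgHom.id ℂ W :=
    h.hom_ext (e := e) hΦ fun i j => by
      rw [StarAlgHom.comp_apply, hΔ, map_sum]
      simp only [MinTensor.characterRight_apply, MinTensor.sliceRight_tmul]
      change ∑ k, ε (coef e Φ k j) • coef e Φ i k = coef e Φ i j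
      simp [hε]
  exact ⟨ε, fun a => ⟨DFunLike.congr_fun hl a, DFunLike.congr_fun hr a⟩⟩

end Counit

/-! ### The family of all maps -/

section AllMaps

variable {M E W : Type u} [CStarAlgebra M] [FiniteDimensional ℂ M] [CStarAlgebra E]
  [CStarAlgebra W]

theorem IsFamilyOfAllMaps.existsUnique_encodesComposition {Φ : QuantumFamily M M E}
    (h : IsFamilyOfAllMaps Φ) : ∃! Δ : E →⋆ₐ[ℂ] E ⊗ₘ E, EncodesComposition Φ Δ := by
  simp only [encodesComposition_iff]
  exact h _ (selfComposition Φ)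

/-- Both sides of the intertwining relation send the coefficient `u i j` of `Φ` to
`∑ k, v i k ⊗ v k j`, where `v` are the coefficients of `Φ'`. -/
theorem IsFamilyOfAllMaps.intertwines {Φ : QuantumFamily M M E} {Φ' : QuantumFamily M M W}
    (h : IsFamilyOfAllMaps Φ) {ΔE : E →⋆ₐ[ℂ] E ⊗ₘ E} {Δ : W →⋆ₐ[ℂ] W ⊗ₘ W} {Λ : E →⋆ₐ[ℂ] W}
    (hE : EncodesComposition Φ ΔE) (hΔ : EncodesComposition Φ' Δ)
    (hΛ : changeParameter Φ Λ = Φ') : Intertwines Λ ΔE Δ := by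
  let e := Module.finBasis ℂ M |>.reindex Equiv.ulift.{u}.symm
  rw [encodesComposition_iff_coef (e := e)] at hE hΔ
  rw [changeParameter_eq_iff (e := e)] at hΛ
  refine h.hom_ext (e := e) fun i j => ?_
  simp only [StarAlgHom.comp_apply, hE, hΔ, hΛ, map_sum, MinTensor.map_of_tmul]

end AllMaps

end

theorem mainTheorem3 {M : Type u} [CStarAlgebra M] [FiniteDimensional ℂ M]
    (ω : M →L[ℂ] ℂ) (hω : IsState ω) :
    ∃ (W : Type u) (_ : CStarAlgebra W) (Φω : QuantumFamily M M W),
      ClassifiesPreserving Φω ω hω ∧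
      PreservesState Φω ω hω ∧
      (∀ (W' : Type u) [CStarAlgebra W'] (Φ' : QuantumFamily M M W'),
        ClassifiesPreserving Φ' ω hω → PreservesState Φ' ω hω →
          ∃! θ : W ≃⋆ₐ[ℂ] W', changeParameter Φω (θ : W →⋆ₐ[ℂ] W') = Φ') ∧
      ∃ Δ : W →⋆ₐ[ℂ] W ⊗ₘ W,
        EncodesComposition Φω Δ ∧
        IsQuantumSemigroupWithUnit Δ ∧
        ∀ (E : Type u) [CStarAlgebra E] (Φ : QuantumFamily M M E), IsFamilyOfAllMaps Φ →
          (∃! ΔE : E →⋆ₐ[ℂ] E ⊗ₘ E, EncodesComposition Φ ΔE) ∧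
          (∃! Λ : E →⋆ₐ[ℂ] W, changeParameter Φ Λ = Φω) ∧
          ∀ (ΔE : E →⋆ₐ[ℂ] E ⊗ₘ E) (Λ : E →⋆ₐ[ℂ] W),
            EncodesComposition Φ ΔE → changeParameter Φ Λ = Φω → Intertwines Λ ΔE Δ := by
  -- The basis is indexed by a lift of `Fin n`, so that the free `*`-algebra lives in `Type u`.
  let e := Module.finBasis ℂ M |>.reindex Equiv.ulift.{u}.symm
  have hc : ClassifiesPreserving (universalFamily ω hω e) ω hω :=
    classifiesPreserving_universalFamily
  have hp : PreservesState (universalFamily ω hω e) ω hω := preservesState_universalFamily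
  obtain ⟨Δ, hΔ, -⟩ := hc _ _ hp.selfComposition
  have hΔ' : EncodesComposition (universalFamily ω hω e) Δ := encodesComposition_iff.2 hΔ
  have hcoef := (encodesComposition_iff_coef (e := e)).1 hΔ'
  exact ⟨UniversalAlgebra ω hω e, inferInstance, universalFamily ω hω e, hc, hp,
    fun W' _ Φ' hc' hp' => hc.existsUnique_equiv hp hc' hp', Δ, hΔ',
    ⟨isCoassociative_of_coef hc hp hcoef, exists_isCounit_of_coef hc hp hcoef⟩,
    fun E _ Φ hΦ => ⟨hΦ.existsUnique_encodesComposition, hΦ _ _,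
      fun ΔE Λ hE hΛ => hΦ.intertwines hE hΔ' hΛ⟩⟩
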